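/- \textbf{Definitions.} A \emph{sketch} $\mathcal S=(\mathsf S,\mathsf L_{\mathcal S},\mathsf C_{\mathcal S})$ is a locally small category $\mathsf S$ with a class $\mathsf L_{\mathcal S}$ of cones and a class $\mathsf C_{\mathcal S}$ of cocones over diagrams $K\to\mathsf S$ indexed by essentially small categories $K$. A \emph{morphism of sketches} $F\colon\mathcal S\to\mathcal T$ is a functor $\mathsf S\to\mathsf T$ that sends each cone in $\mathsf L_{\mathcal S}$ (cocone in $\mathsf C_{\mathcal S}$) to one that is naturally isomorphic to a cone in $\mathsf L_{\mathcal T}$ (cocone in $\mathsf C_{\mathcal T}$). With natural transformations as 2-cells, sketches form a 2-category $\mathsf{Skt}$. A sketch is \emph{small} if $\mathsf S$ is essentially small and $\mathsf C_{\mathcal S}$ is, up to natural isomorphism of cocones and equivalence of the indexing categories, a set. A \emph{left sketch} is a sketch $\mathcal M$ such that $\mathsf M$ is cocomplete and $\mathsf C_{\mathcal M}$ consists of exactly all colimit cocones over essentially small diagrams. A morphism $F\colon\mathcal S\to\mathcal T$ is a \emph{left Morita equivalence} if $F^*\colon\mathsf{Skt}(\mathcal T,\mathcal M)\to\mathsf{Skt}(\mathcal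 S,\mathcal M)$ is an equivalence of categories for every left sketch $\mathcal M$. A sketch $\mathcal S$ is \emph{Morita small} if there is a left Morita equivalence $\mathcal D\to\mathcal S$ with $\mathcal D$ a small sketch. Let $\mathsf{Skt}^{\mathsf M}$ be the full sub-2-category of $\mathsf{Skt}$ on the Morita small sketches, and $\mathsf{LSkt}^{\mathsf M}$ its full sub-2-category on those that are left sketches, with inclusion $U\colon\mathsf{LSkt}^{\mathsf M}\to\mathsf{Skt}^{\mathsf M}$. Let $\mathcal S$ be a sketch and $y\colon\mathsf S\to[\mathsf S^{op},\mathsf{Set}]$ the Yoneda embedding. Let $\mathcal H$ be the class of the canonical maps $\rho_\delta\colon\operatorname{colim}(y\circ d)\to y(s)$ for $\delta\colon d\Rightarrow\Delta(s)$ in $\mathsf C_{\mathcal S}$, and let $\mathcal H^{\perp}\subseteq[\mathsf S^{op},\mathsf{Set}]$ be the full subcategory of the presheaves orthogonal to all $\rho_\delta$. A \emph{left sketch classifier} of $\mathcal S$ is a sketch $\hat{\mathcal S}$ with a morphism $J_{\mathcal S}\colon\mathcal S\to\hat{\mathcal S}$ such that the underlying category of $\hat{\mathcal S}$ is (equivalent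 to) $\mathcal H^\perp$; the functor $J_{\mathcal S}$ sends $s$, naturally in $s$, to the reflection of $y(s)$ in $\mathcal H^\perp$; $\mathsf L_{\hat{\mathcal S}}$ is the class of the images under $J_{\mathcal S}$ of the cones in $\mathsf L_{\mathcal S}$; and $\mathsf C_{\hat{\mathcal S}}$ is the class of all colimit cocones over essentially small diagrams. \textbf{Theorem} (Diaconescu for left sketches). $\mathsf{LSkt}^{\mathsf M}$ is bireflective in $\mathsf{Skt}^{\mathsf M}$, with the left sketch classifier as reflector and an equivalence as counit. That is, there are a pseudofunctor $\widehat{(-)}\colon\mathsf{Skt}^{\mathsf M}\to\mathsf{LSkt}^{\mathsf M}$ and a biadjunction $\widehat{(-)}\dashv U$ (a pseudonatural transformation $\eta\colon 1\Rightarrow U\widehat{(-)}$ such that $g\mapsto U(g)\circ\eta_{\mathcal S}$ is an equivalence of categories $\mathsf{LSkt}^{\mathsf M}(\hat{\mathcal S},\mathcal M)\simeq\mathsf{Skt}^{\mathsf M}(\mathcal S,U\mathcal M)$ for all Morita small sketches $\mathcal S$ and Morita small left sketches $\mathcal M$) such that, for every Morita small sketch $\mathcal S$, the pair $(\hat{\mathcal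 S},\eta_{\mathcal S})$ is a left sketch classifier of $\mathcal S$, and, for every Morita small left sketch $\mathcal M$, the counit $\widehat{U\mathcal M}\to\mathcal M$ is an equivalence in $\mathsf{LSkt}^{\mathsf M}$. -/

import Mathlib

open CategoryTheory CategoryTheory.Limits

universe u w₁ w₂ v₁ v₂ u₁ u₂

/-! ### Isomorphisms of cones and cocones over possibly different diagrams of the same shape -/

section Cones

variable {K : Type u₁} [Category.{v₁} K] {C : Type u₂} [Category.{v₂} C]

/-- Two cones, over diagrams `d` and `e` of the same shape, are naturally isomorphic: there are
isomorphisms of the diagrams and of the apices which are compatible with the projections. -/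
def ConeIso {d e : K ⥤ C} (c : Cone d) (c' : Cone e) : Prop :=
  ∃ (α : d ≅ e) (i : c.pt ≅ c'.pt), ∀ k, i.hom ≫ c'.π.app k = c.π.app k ≫ α.hom.app k

/-- Two cocones, over diagrams `d` and `e` of the same shape, are naturally isomorphic. -/
def CoconeIso {d e : K ⥤ C} (c : Cocone d) (c' : Cocone e) : Prop :=
  ∃ (α : d ≅ e) (i : c.pt ≅ c'.pt), ∀ k, c.ι.app k ≫ i.hom = α.hom.app k ≫ c'.ι.app k

lemma ConeIso.refl {d : K ⥤ C} (c : Cone d) : ConeIso c c :=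
  ⟨Iso.refl _, Iso.refl _, by simp⟩

lemma CoconeIso.refl {d : K ⥤ C} (c : Cocone d) : CoconeIso c c :=
  ⟨Iso.refl _, Iso.refl _, by simp⟩

lemma ConeIso.trans {d e f : K ⥤ C} {c : Cone d} {c' : Cone e} {c'' : Cone f}
    (h : ConeIso c c') (h' : ConeIso c' c'') : ConeIso c c'' := by
  obtain ⟨α, i, hi⟩ := h
  obtain ⟨β, j, hj⟩ := h'
  exact ⟨α ≪≫ β, i ≪≫ j, fun k => by simp [hj, reassoc_of% hi]⟩

lemma CoconeIso.trans {d e f : K ⥤ C} {c : Cocone d} {c' : Cocone e} {c'' : Cocone f}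
    (h : CoconeIso c c') (h' : CoconeIso c' c'') : CoconeIso c c'' := by
  obtain ⟨α, i, hi⟩ := h
  obtain ⟨β, j, hj⟩ := h'
  exact ⟨α ≪≫ β, i ≪≫ j, fun k => by simp [← hj, reassoc_of% hi]⟩

variable {D : Type w₁} [Category.{w₂} D]

lemma ConeIso.map (F : C ⥤ D) {d e : K ⥤ C} {c : Cone d} {c' : Cone e}
    (h : ConeIso c c') : ConeIso (F.mapCone c) (F.mapCone c') := by
  obtain ⟨α, i, hi⟩ := h
  exact ⟨Functor.isoWhiskerRight α F, F.mapIso i, fun k =>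
    (F.map_comp _ _).symm.trans ((congrArg F.map (hi k)).trans (F.map_comp _ _))⟩

lemma CoconeIso.map (F : C ⥤ D) {d e : K ⥤ C} {c : Cocone d} {c' : Cocone e}
    (h : CoconeIso c c') : CoconeIso (F.mapCocone c) (F.mapCocone c') := by
  obtain ⟨α, i, hi⟩ := h
  exact ⟨Functor.isoWhiskerRight α F, F.mapIso i, fun k =>
    (F.map_comp _ _).symm.trans ((congrArg F.map (hi k)).trans (F.map_comp _ _))⟩

end Cones

/-! ### The 2-category of sketches -/

/-- A sketch: a (possibly large) locally small category with a class of cones and a class of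
cocones over essentially small diagrams. Sets are the types in `Type u`, and classes are the types
in `Type (u + 1)`. -/
structure Sketch : Type (u + 2) where
  carrier : Type (u + 1)
  [category : Category.{u} carrier]
  /-- The class of specified cones. -/
  cones : ∀ {K : Type (u + 1)} [Category.{u} K] {d : K ⥤ carrier}, Cone d → Prop
  /-- The class of specified cocones. -/
  cocones : ∀ {K : Type (u + 1)} [Category.{u} K] {d : K ⥤ carrier}, Cocone d → Prop
  essentiallySmall_of_cones : ∀ {K : Type (u + 1)} [Category.{u} K] {d : K ⥤ carrier}
    (c : Cone d), cones c → EssentiallySmall.{u} K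
  essentiallySmall_of_cocones : ∀ {K : Type (u + 1)} [Category.{u} K] {d : K ⥤ carrier}
    (c : Cocone d), cocones c → EssentiallySmall.{u} K

namespace Sketch

attribute [instance] Sketch.category

/-- A morphism of sketches is a functor that sends every specified (co)cone to a (co)cone which is
naturally isomorphic to a specified one. -/
@[ext]
structure Hom (S T : Sketch.{u}) where
  functor : S.carrier ⥤ T.carrier
  map_cones : ∀ {K : Type (u + 1)} [Category.{u} K] {d : K ⥤ S.carrier} (c : Cone d),
    S.cones c → ∃ (e : K ⥤ T.carrier) (c' : Cone e),
      T.cones c' ∧ ConeIso (functor.mapCone c) c'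
  map_cocones : ∀ {K : Type (u + 1)} [Category.{u} K] {d : K ⥤ S.carrier} (c : Cocone d),
    S.cocones c → ∃ (e : K ⥤ T.carrier) (c' : Cocone e),
      T.cocones c' ∧ CoconeIso (functor.mapCocone c) c'

/-- The identity morphism of a sketch. -/
def Hom.id (S : Sketch.{u}) : Hom S S where
  functor := 𝟭 S.carrier
  map_cones {_ _ d} c hc := ⟨d, c, hc, Iso.refl _, Iso.refl _, by simp⟩
  map_cocones {_ _ d} c hc := ⟨d, c, hc, Iso.refl _, Iso.refl _, by simp⟩

/-- The composition of morphisms of sketches. -/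
def Hom.comp {S T R : Sketch.{u}} (F : Hom S T) (G : Hom T R) : Hom S R where
  functor := F.functor ⋙ G.functor
  map_cones c hc := by
    obtain ⟨e, c', hc', h⟩ := F.map_cones c hc
    obtain ⟨e', c'', hc'', h'⟩ := G.map_cones c' hc'
    exact ⟨e', c'', hc'', (h.map G.functor).trans h'⟩
  map_cocones c hc := by
    obtain ⟨e, c', hc', h⟩ := F.map_cocones c hc
    obtain ⟨e', c'', hc'', h'⟩ := G.map_cocones c' hc'
    exact ⟨e', c'', hc'', (h.map G.functor).trans h'⟩

/-- A 2-cell between morphisms of sketches is a natural transformation of the underlying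
functors. -/
@[ext]
structure Hom₂ {S T : Sketch.{u}} (F G : Hom S T) where
  natTrans : F.functor ⟶ G.functor

section

/-- Sketches and their morphisms. -/
@[reducible]
def categoryStruct : CategoryStruct Sketch.{u} where
  Hom := Hom
  id := Hom.id
  comp := Hom.comp

/-- The category of morphisms between two sketches. -/
@[reducible]
def homCategory (S T : Sketch.{u}) : Category (Hom S T) where
  Hom F G := Hom₂ F G
  id F := ⟨𝟙 F.functor⟩
  comp α β := ⟨α.natTrans ≫ β.natTrans⟩

attribute [local instance] homCategory

lemma hom₂_ext_aux {S T : Sketch.{u}} {F G : Hom S T} {α β : F ⟶ G}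
    (h : ∀ x, α.natTrans.app x = β.natTrans.app x) : α = β :=
  Hom₂.ext (NatTrans.ext (funext h))

/-- An invertible 2-cell from an isomorphism of the underlying functors. -/
def isoMkAux {S T : Sketch.{u}} {F G : Hom S T} (e : F.functor ≅ G.functor) : F ≅ G where
  hom := ⟨e.hom⟩
  inv := ⟨e.inv⟩
  hom_inv_id := Hom₂.ext e.hom_inv_id
  inv_hom_id := Hom₂.ext e.inv_hom_id

/-- The 2-category of (possibly large, locally small) sketches. -/
instance bicategory : Bicategory Sketch.{u} where
  toCategoryStruct := categoryStruct
  homCategory := homCategory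
  whiskerLeft {_ _ _} F {_ _} α := ⟨Functor.whiskerLeft F.functor α.natTrans⟩
  whiskerRight {_ _ _} {_ _} α H := ⟨Functor.whiskerRight α.natTrans H.functor⟩
  associator F G H := isoMkAux (Functor.associator F.functor G.functor H.functor)
  leftUnitor F := isoMkAux F.functor.leftUnitor
  rightUnitor F := isoMkAux F.functor.rightUnitor
  whiskerLeft_id _ _ := hom₂_ext_aux fun _ => rfl
  whiskerLeft_comp _ _ _ _ _ _ := hom₂_ext_aux fun _ => rfl
  id_whiskerLeft α := hom₂_ext_aux fun x =>
    show α.natTrans.app x = 𝟙 _ ≫ α.natTrans.app x ≫ 𝟙 _ by simp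
  comp_whiskerLeft F G _ _ α := hom₂_ext_aux fun x =>
    let y := G.functor.obj (F.functor.obj x)
    show α.natTrans.app y = 𝟙 _ ≫ α.natTrans.app y ≫ 𝟙 _ by simp
  id_whiskerRight F G := hom₂_ext_aux fun x => G.functor.map_id (F.functor.obj x)
  comp_whiskerRight α β H := hom₂_ext_aux fun x =>
    H.functor.map_comp (α.natTrans.app x) (β.natTrans.app x)
  whiskerRight_id α := hom₂_ext_aux fun x =>
    show α.natTrans.app x = 𝟙 _ ≫ α.natTrans.app x ≫ 𝟙 _ by simp
  whiskerRight_comp α G H := hom₂_ext_aux fun x =>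
    let f := H.functor.map (G.functor.map (α.natTrans.app x))
    show f = 𝟙 _ ≫ f ≫ 𝟙 _ by simp
  whisker_assoc F _ _ α H := hom₂_ext_aux fun x =>
    let f := H.functor.map (α.natTrans.app (F.functor.obj x))
    show f = 𝟙 _ ≫ f ≫ 𝟙 _ by simp
  whisker_exchange α β := hom₂_ext_aux fun x => (β.natTrans.naturality (α.natTrans.app x)).symm
  pentagon F G H I := hom₂_ext_aux fun x =>
    show I.functor.map (𝟙 (H.functor.obj (G.functor.obj (F.functor.obj x)))) ≫ 𝟙 _ ≫ 𝟙 _ =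
      𝟙 _ ≫ 𝟙 _ by simp
  triangle F G := hom₂_ext_aux fun x =>
    show 𝟙 _ ≫ 𝟙 _ = G.functor.map (𝟙 (F.functor.obj x)) by simp

end

/-- A sketch is small if its underlying category is essentially small and its specified cocones
form, up to natural isomorphism and equivalence of the indexing categories, a set. -/
def IsSmall (S : Sketch.{u}) : Prop :=
  EssentiallySmall.{u} S.carrier ∧
    ∃ (I : Type u) (K : I → Type (u + 1)) (_ : ∀ i, Category.{u} (K i))
      (d : ∀ i, K i ⥤ S.carrier) (δ : ∀ i, Cocone (d i)),
      (∀ i, S.cocones (δ i)) ∧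
      ∀ {L : Type (u + 1)} [Category.{u} L] {e : L ⥤ S.carrier} (ε : Cocone e),
        S.cocones ε → ∃ (i : I) (w : CategoryTheory.Equivalence L (K i)),
          CoconeIso ε ((δ i).whisker w.functor)

/-- A left sketch: the underlying category is cocomplete, and the specified cocones are exactly
the colimit cocones over essentially small diagrams. -/
def IsLeft (S : Sketch.{u}) : Prop :=
  HasColimits S.carrier ∧
    ∀ {K : Type (u + 1)} [Category.{u} K] {d : K ⥤ S.carrier} (c : Cocone d),
      S.cocones c ↔ EssentiallySmall.{u} K ∧ Nonempty (IsColimit c)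

/-- A morphism of sketches `F : S ⟶ T` is a left Morita equivalence if precomposition with `F` is
an equivalence from the category of morphisms `T ⟶ M` to that of morphisms `S ⟶ M`, for every
left sketch `M`. -/
def IsLeftMoritaEquivalence {S T : Sketch.{u}} (F : S ⟶ T) : Prop :=
  ∀ M : Sketch.{u}, M.IsLeft → (Bicategory.precomp M F).IsEquivalence

/-- A sketch is (left) Morita small if it receives a left Morita equivalence from a small
sketch. -/
def IsMoritaSmall (S : Sketch.{u}) : Prop :=
  ∃ (D : Sketch.{u}) (j : D ⟶ S), D.IsSmall ∧ IsLeftMoritaEquivalence j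

end Sketch

/-! ### The left sketch classifier -/

namespace Sketch

/-- The canonical comparison maps of presheaves `colim (y ∘ d) ⟶ y s`, where `y` is the Yoneda
embedding, for all specified cocones `δ : d ⇒ Δ s` of the sketch `S`. -/
inductive comparisonMaps (S : Sketch.{u}) : MorphismProperty (S.carrierᵒᵖ ⥤ Type u)
  | mk {K : Type (u + 1)} [Category.{u} K] {d : K ⥤ S.carrier} (δ : Cocone d)
      (hδ : S.cocones δ) (c : Cocone (d ⋙ yoneda)) (hc : IsColimit c) :
      comparisonMaps S (hc.desc (yoneda.mapCocone δ))

/-- The category of the presheaves on `S` that are orthogonal to all the comparison maps. -/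
abbrev OrthogonalPresheaf (S : Sketch.{u}) : Type (u + 1) :=
  S.comparisonMaps.isLocal.FullSubcategory

/-- The inclusion of the orthogonal presheaves into all presheaves. -/
abbrev orthogonalInclusion (S : Sketch.{u}) : S.OrthogonalPresheaf ⥤ S.carrierᵒᵖ ⥤ Type u :=
  S.comparisonMaps.isLocal.ι

/-- The class of the images of the specified cones of `S` under a functor. -/
inductive imageCones (S : Sketch.{u}) {D : Type (u + 1)} [Category.{u} D] (F : S.carrier ⥤ D) :
    ∀ {K : Type (u + 1)} [Category.{u} K] {d : K ⥤ D}, Cone d → Prop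
  | mk {K : Type (u + 1)} [Category.{u} K] {d : K ⥤ S.carrier} (c : Cone d) (hc : S.cones c) :
      imageCones S F (F.mapCone c)

/-- The structure of a left sketch classifier of `S` on a sketch `T` and a morphism `J : S ⟶ T`:
the underlying category of `T` is the category of orthogonal presheaves (made locally small by an
equivalence), `J` sends an object `s` to the reflection of the representable presheaf `y s` in it,
the specified cones of `T` are the images under `J` of those of `S`, and the specified cocones
of `T` are all the colimit cocones. -/
structure LeftClassifier (S T : Sketch.{u}) (J : S ⟶ T) where
  /-- The identification of the underlying category with the orthogonal presheaves. -/
  equiv : CategoryTheory.Equivalence T.carrier S.OrthogonalPresheaf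
  /-- The reflection arrows `y s ⟶ J s`. -/
  reflection : (yoneda : S.carrier ⥤ S.carrierᵒᵖ ⥤ Type u) ⟶
    J.functor ⋙ equiv.functor ⋙ S.orthogonalInclusion
  /-- Every map from `y s` to an orthogonal presheaf factors uniquely through `y s ⟶ J s`. -/
  bijective_reflection : ∀ (s : S.carrier) (P : S.OrthogonalPresheaf),
    Function.Bijective fun g : equiv.functor.obj (J.functor.obj s) ⟶ P =>
      reflection.app s ≫ S.orthogonalInclusion.map g
  cones_iff : ∀ {K : Type (u + 1)} [Category.{u} K] {d : K ⥤ T.carrier} (c : Cone d),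
    T.cones c ↔ S.imageCones J.functor c
  cocones_iff : ∀ {K : Type (u + 1)} [Category.{u} K] {d : K ⥤ T.carrier} (c : Cocone d),
    T.cocones c ↔ EssentiallySmall.{u} K ∧ Nonempty (IsColimit c)

end Sketch

/-! ### Biadjunctions -/

section Biadjunctions

variable {B : Type u₁} [Bicategory.{w₁, v₁} B] {C : Type u₂} [Bicategory.{w₂, v₂} C]

/-- The functor `(F X ⟶ Y) ⥤ (X ⟶ G Y)`, `g ↦ η_X ≫ G g`, for a pseudonatural transformation
`η : 𝟙 ⟶ G F`. -/
def unitHomFunctor (F : Pseudofunctor B C) (G : Pseudofunctor C B)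
    (η : Pseudofunctor.StrongTrans (Pseudofunctor.id B) (F.comp G)) (X : B) (Y : C) :
    (F.obj X ⟶ Y) ⥤ (X ⟶ G.obj Y) where
  obj g := η.app X ≫ G.map g
  map β := Bicategory.whiskerLeft (η.app X) (G.map₂ β)
  map_id g := by
    rw [G.map₂_id]
    exact Bicategory.whiskerLeft_id _ _
  map_comp β γ := by
    rw [G.map₂_comp]
    exact Bicategory.whiskerLeft_comp _ _ _

/-- A biadjunction `F ⊣ G` between pseudofunctors: a pseudonatural transformation `η : 𝟙 ⟶ G F`
such that the functors `g ↦ η_X ≫ G g` are equivalences of categories between `F X ⟶ Y` and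
`X ⟶ G Y` (these are then pseudonatural in `X` and `Y`). -/
structure Biadjunction (F : Pseudofunctor B C) (G : Pseudofunctor C B) where
  unit : Pseudofunctor.StrongTrans (Pseudofunctor.id B) (F.comp G)
  isEquivalence : ∀ (X : B) (Y : C), (unitHomFunctor F G unit X Y).IsEquivalence

/-- The counit `F (G Y) ⟶ Y` of a biadjunction: the 1-cell, unique up to isomorphism, that
corresponds to the identity of `G Y`. -/
noncomputable def Biadjunction.counit {F : Pseudofunctor B C} {G : Pseudofunctor C B}
    (h : Biadjunction F G) (Y : C) : F.obj (G.obj Y) ⟶ Y :=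
  haveI := h.isEquivalence (G.obj Y) Y
  (unitHomFunctor F G h.unit (G.obj Y) Y).inv.obj (𝟙 (G.obj Y))

/-- A 1-cell in a bicategory is an equivalence if it has an inverse up to invertible 2-cells. -/
def IsEquivalence₁ {X Y : B} (f : X ⟶ Y) : Prop :=
  ∃ g : Y ⟶ X, Nonempty (f ≫ g ≅ 𝟙 X) ∧ Nonempty (g ≫ f ≅ 𝟙 Y)

end Biadjunctions

/-! ### Morita small sketches and Morita small left sketches -/

/-- The 2-category of Morita small sketches: the full sub-2-category of the 2-category of sketches
on the Morita small ones. -/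
abbrev MoritaSmallSketch : Type (u + 2) :=
  Bicategory.InducedBicategory Sketch.{u} (Subtype.val : {S : Sketch.{u} // S.IsMoritaSmall} → _)

/-- The sketch underlying a Morita small sketch. -/
abbrev MoritaSmallSketch.sketch (S : MoritaSmallSketch.{u}) : Sketch.{u} := Subtype.val S

/-- The 2-category of Morita small left sketches: the full sub-2-category of the 2-category of
Morita small sketches on the left sketches. -/
abbrev MoritaSmallLeftSketch : Type (u + 2) :=
  Bicategory.InducedBicategory MoritaSmallSketch.{u}
    (Subtype.val : {S : MoritaSmallSketch.{u} // S.sketch.IsLeft} → _)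

/-- The inclusion of Morita small left sketches into Morita small sketches. -/
abbrev leftInclusion : Pseudofunctor MoritaSmallLeftSketch.{u} MoritaSmallSketch.{u} :=
  Bicategory.InducedBicategory.forget.toPseudofunctor

/-! By Yoneda, a presheaf is orthogonal to `ρ_δ` exactly when it sends `δ` to a limit cone
(`bijective_desc_comp_iff`). So the classifier can be handled through functors `J : S ⥤ T` whose
nerve `X ↦ T(J -, X)` is fully faithful with the orthogonal presheaves as essential image
(`IsClassifying`).

For a small sketch, orthogonality is tested on a set of maps between presentable presheaves. The
orthogonal presheaves are therefore reflective and cocomplete, and the reflected Yoneda embedding is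
classifying (`IsSmall.exists_isClassifying`). Given `F : S ⥤ M` that sends specified cocones to
colimits, each presheaf `M(F -, m)` is orthogonal, hence the nerve of some `X`. This `X` is the
value at `m` of a right adjoint to the left Kan extension of `F` along `J`, so that extension is
cocontinuous and restricts to `F` (`exists_counit`, `exists_extension`). Uniqueness holds because
`J` is dense. Thus `J` is a left Morita equivalence.

For a left Morita equivalence `j : D ⟶ S` with `D` small, `J : D ⥤ T` extends along `j` to `G : S ⥤
T`. Orthogonal presheaves on `S` are sketch morphisms to `setOp`, itself a left sketch, so
restriction along `j` is fully faithful on them (`bijective_restrict`). Hence `G` is again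
classifying (`of_isLeftMoritaEquivalence`), and it is a left Morita equivalence by cancellation.

The biadjunction is then formal: precomposition with the unit is an equivalence, so 1-cells and
2-cells extend along it, and coherence can be checked on the image of the unit. A left Morita
equivalence between left sketches is invertible, which gives the counit. -/

/-! ### Presheaves that send cocones to limit cones -/

section TakesToLimit

open Opposite

variable {K : Type u₁} [Category.{v₁} K] {C : Type u₂} [Category.{v₂} C]

/-- The presheaf `P` sends the cocone `δ` to a limit cone of sets: every compatible family of
elements has a unique amalgamation. -/
def TakesToLimit (P : Cᵒᵖ ⥤ Type w₁) {d : K ⥤ C} (δ : Cocone d) : Prop :=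
  ∀ x : ∀ k, P.obj (op (d.obj k)),
    (∀ ⦃k k' : K⦄ (f : k ⟶ k'), P.map (d.map f).op (x k') = x k) →
      ∃! y : P.obj (op δ.pt), ∀ k, P.map (δ.ι.app k).op y = x k

/-- Compatible families in `C(d -, X)` are the cocones with apex `X`. Colimits thus become a
condition on presheaves, which can be moved across isomorphisms. -/
lemma nonempty_isColimit_iff {d : K ⥤ C} (δ : Cocone d) :
    Nonempty (IsColimit δ) ↔ ∀ X, TakesToLimit (yoneda.obj X) δ := by
  constructor
  · rintro ⟨h⟩ X x hx
    let s : Cocone d := ⟨X, { app := x, naturality := fun k k' f => by simpa using hx f }⟩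
    exact ⟨h.desc s, fun k => h.fac s k, fun y hy => h.uniq s y hy⟩
  · intro h
    have h' (s : Cocone d) := h s.pt s.ι.app (fun k k' f => s.w f)
    choose desc fac uniq using h'
    exact ⟨⟨desc, fac, fun s m hm => uniq s m hm⟩⟩

lemma TakesToLimit.of_iso {P Q : Cᵒᵖ ⥤ Type w₁} (e : P ≅ Q) {d : K ⥤ C} {δ : Cocone d}
    (h : TakesToLimit P δ) : TakesToLimit Q δ := by
  intro x hx
  obtain ⟨y, hy, hy'⟩ := h (fun k => e.inv.app _ (x k)) (fun k k' f => by
    rw [← NatTrans.naturality_apply, hx])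
  refine ⟨e.hom.app _ y, fun k => ?_, fun z hz => ?_⟩
  · refine (e.hom.naturality_apply (δ.ι.app k).op y).symm.trans ?_
    rw [hy]
    simp
  · have := hy' (e.inv.app _ z) (fun k =>
      (e.inv.naturality_apply (δ.ι.app k).op z).symm.trans (congr_arg _ (hz k)))
    simp [← this]

lemma TakesToLimit.of_coconeIso {P : Cᵒᵖ ⥤ Type w₁} {d e : K ⥤ C} {δ : Cocone d} {ε : Cocone e}
    (h : TakesToLimit P δ) (i : CoconeIso ε δ) : TakesToLimit P ε := by
  obtain ⟨α, i, hi⟩ := i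
  have hi' (k) : δ.ι.app k ≫ i.inv = α.inv.app k ≫ ε.ι.app k := by
    rw [Iso.comp_inv_eq, Category.assoc, hi]; simp
  intro x hx
  obtain ⟨y, hy, hy'⟩ := h (fun k => P.map (α.inv.app k).op (x k)) (fun k k' f => by
    rw [← hx f, ← Functor.map_comp_apply, ← Functor.map_comp_apply, ← op_comp, ← op_comp,
      α.inv.naturality])
  refine ⟨P.map i.hom.op y, fun k => ?_, fun z hz => ?_⟩
  · dsimp only
    rw [← Functor.map_comp_apply, ← op_comp, hi, op_comp, Functor.map_comp_apply, hy,
      ← Functor.map_comp_apply, ← op_comp]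
    simp
  · have := hy' (P.map i.inv.op z) (fun k => by
      rw [← Functor.map_comp_apply, ← op_comp, hi', op_comp, Functor.map_comp_apply, hz])
    rw [← this, ← Functor.map_comp_apply, ← op_comp]
    simp

lemma TakesToLimit.whisker {P : Cᵒᵖ ⥤ Type w₁} {d : K ⥤ C} {δ : Cocone d}
    (h : TakesToLimit P δ) {L : Type w₂} [Category.{u} L] (w : CategoryTheory.Equivalence L K) :
    TakesToLimit P (δ.whisker w.functor) := by
  intro x hx
  -- A family indexed by `L` becomes one indexed by `K` by evaluating at the inverse of `w` and
  -- restricting along its inverse counit.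
  have hx' : ∀ ⦃k k' : K⦄ (f : k ⟶ k'), P.map (d.map f).op
      (P.map (d.map (w.counitInv.app k')).op (x (w.inverse.obj k'))) =
      P.map (d.map (w.counitInv.app k)).op (x (w.inverse.obj k)) := fun k k' f => by
    rw [← hx (w.inverse.map f), ← Functor.map_comp_apply, ← op_comp, Functor.comp_map,
      ← Functor.map_comp_apply, ← op_comp, ← d.map_comp, ← d.map_comp]
    have := w.counitInv.naturality f
    dsimp at this
    rw [this]
  obtain ⟨y, hy, hy'⟩ := h _ hx'
  refine ⟨y, fun l => ?_, fun z hz => hy' z fun k => ?_⟩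
  · refine (hy (w.functor.obj l)).trans ?_
    rw [w.counitInv_app_functor]
    exact hx (w.unit.app l)
  · rw [← hz, ← Functor.map_comp_apply]
    exact congr_arg (fun f : d.obj k ⟶ δ.pt => P.map f.op z) (δ.w (w.counitInv.app k)).symm

/-- A presheaf is orthogonal to the comparison map of a cocone if and only if it sends the cocone
to a limit cone. -/
lemma bijective_desc_comp_iff {P : Cᵒᵖ ⥤ Type v₂} {d : K ⥤ C} (δ : Cocone d)
    {c : Cocone (d ⋙ yoneda)} (hc : IsColimit c) :
    Function.Bijective (fun g : yoneda.obj δ.pt ⟶ P => hc.desc (yoneda.mapCocone δ) ≫ g) ↔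
      TakesToLimit P δ := by
  -- Under Yoneda, restricting an element along a leg of `δ` is precomposing with the comparison map
  -- and a leg of `c`.
  have key (g : yoneda.obj δ.pt ⟶ P) (k : K) :
      P.map (δ.ι.app k).op (yonedaEquiv g) = yonedaEquiv
        (c.ι.app k ≫ hc.desc (yoneda.mapCocone δ) ≫ g) := by
    rw [hc.fac_assoc, yonedaEquiv_naturality]
    rfl
  constructor
  · intro h x hx
    let s : Cocone (d ⋙ yoneda) := ⟨P,
      { app k := yonedaEquiv.symm (x k)
        naturality k k' f := by
          dsimp
          rw [Category.comp_id, yonedaEquiv_symm_naturality_left, hx] }⟩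
    obtain ⟨g, hg : _ ≫ g = _⟩ := h.2 (hc.desc s)
    refine ⟨yonedaEquiv g, fun k => ?_, fun y hy => ?_⟩
    · dsimp only
      rw [key, hg, hc.fac]
      exact yonedaEquiv.apply_symm_apply _
    · obtain ⟨g', rfl⟩ := yonedaEquiv.surjective y
      congr 1
      apply h.1
      refine hc.hom_ext fun k => yonedaEquiv.injective ?_
      refine (key g' k).symm.trans ((hy k).trans ?_)
      dsimp only
      rw [hg, hc.fac]
      exact (yonedaEquiv.apply_symm_apply _).symm
  · intro h
    constructor
    · intro g g' hg
      apply yonedaEquiv.injective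
      refine (h (fun k => P.map (δ.ι.app k).op (yonedaEquiv g)) (fun k k' f => ?_)).unique
        (fun k => rfl) (fun k => ?_)
      · rw [← Functor.map_comp_apply, ← op_comp, δ.w]
      · rw [key, key]
        exact congr_arg (fun t => yonedaEquiv (c.ι.app k ≫ t)) hg.symm
    · intro t
      obtain ⟨y, hy, -⟩ := h (fun k => yonedaEquiv (c.ι.app k ≫ t)) (fun k k' f => by
        rw [yonedaEquiv_naturality, ← c.w f, Category.assoc]
        rfl)
      refine ⟨yonedaEquiv.symm y, hc.hom_ext fun k => yonedaEquiv.injective ?_⟩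
      rw [← key, ← hy, Equiv.apply_symm_apply]

lemma CoconeIso.nonempty_isColimit {d e : K ⥤ C} {δ : Cocone d} {ε : Cocone e}
    (i : CoconeIso ε δ) (h : Nonempty (IsColimit δ)) : Nonempty (IsColimit ε) := by
  rw [nonempty_isColimit_iff] at h ⊢
  exact fun X => (h X).of_coconeIso i

end TakesToLimit

namespace Sketch

lemma isLocal_comparisonMaps_iff (S : Sketch.{u}) (P : S.carrierᵒᵖ ⥤ Type u) :
    S.comparisonMaps.isLocal P ↔
      ∀ {K : Type (u + 1)} [Category.{u} K] {d : K ⥤ S.carrier} (δ : Cocone d),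
        S.cocones δ → TakesToLimit P δ := by
  constructor
  · intro h K _ d δ hδ
    have := S.essentiallySmall_of_cocones δ hδ
    have := hasColimitsOfShape_of_essentiallySmall.{u} K (Type u)
    exact (bijective_desc_comp_iff δ (colimit.isColimit _)).1
      (h _ (comparisonMaps.mk δ hδ _ (colimit.isColimit _)))
  · rintro h _ _ _ ⟨δ, hδ, c, hc⟩
    exact (bijective_desc_comp_iff δ hc).2 (h δ hδ)

end Sketch

/-! ### The nerve of a functor -/

section Nerve

open Opposite

variable {C : Type u₁} [Category.{v₁} C] {T : Type u₂} [Category.{v₂} T]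

/-- The nerve `X ↦ T(J -, X)` of a functor `J : C ⥤ T`. -/
def homNerve (J : C ⥤ T) : T ⥤ Cᵒᵖ ⥤ Type v₂ :=
  yoneda ⋙ (Functor.whiskeringLeft _ _ _).obj J.op

lemma takesToLimit_nerve {K : Type w₁} [Category.{w₂} K] {J : C ⥤ T} {d : K ⥤ C} {δ : Cocone d}
    (h : Nonempty (IsColimit (J.mapCocone δ))) (X : T) :
    TakesToLimit ((homNerve J).obj X) δ :=
  (nonempty_isColimit_iff _).1 h X

lemma hom_ext_of_homNerve (J : C ⥤ T) [(homNerve J).Faithful] {X Y : T} {f g : X ⟶ Y}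
    (h : ∀ (c : C) (x : J.obj c ⟶ X), x ≫ f = x ≫ g) : f = g := by
  apply (homNerve J).map_injective
  ext c x
  exact h c.unop x

lemma exists_hom_of_homNerve (J : C ⥤ T) [(homNerve J).Full] {X Y : T}
    (φ : ∀ c : C, (J.obj c ⟶ X) → (J.obj c ⟶ Y))
    (hφ : ∀ ⦃c c' : C⦄ (t : c ⟶ c') (x : J.obj c' ⟶ X), φ c (J.map t ≫ x) = J.map t ≫ φ c' x) :
    ∃ f : X ⟶ Y, ∀ (c : C) (x : J.obj c ⟶ X), x ≫ f = φ c x := by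
  let α : (homNerve J).obj X ⟶ (homNerve J).obj Y :=
    { app c := ↾fun x => φ c.unop x
      naturality c c' t := by
        ext x
        exact hφ t.unop x }
  exact ⟨(homNerve J).preimage α, fun c x =>
    ConcreteCategory.congr_hom (NatTrans.congr_app ((homNerve J).map_preimage α) (op c)) x⟩

lemma exists_equiv_of_homNerve_iso {M : Type w₁} [Category.{v₂} M] {J : C ⥤ T} {F : C ⥤ M} {X : T}
    {m : M} (β : (homNerve J).obj X ≅ (homNerve F).obj m) :
    ∃ b : ∀ c : C, (J.obj c ⟶ X) ≃ (F.obj c ⟶ m),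
      ∀ ⦃c c' : C⦄ (t : c ⟶ c') (x : J.obj c' ⟶ X), b c (J.map t ≫ x) = F.map t ≫ b c' x :=
  ⟨fun c => (β.app (op c)).toEquiv, fun _ _ t x => β.hom.naturality_apply t.op x⟩

/-- Cocones with apex `Z` over the canonical diagram of `Y` are natural transformations `T(J -, Y) ⟶
T(J -, Z)`; full faithfulness of the nerve turns them into unique maps `Y ⟶ Z`. -/
lemma isDense_of_homNerve (J : C ⥤ T) [(homNerve J).Full] [(homNerve J).Faithful] :
    J.IsDense where
  isDenseAt Y := by
    have (s : Cocone (CostructuredArrow.proj J Y ⋙ J)) :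
        ∃ f : Y ⟶ s.pt, ∀ (c : C) (x : J.obj c ⟶ Y), x ≫ f = s.ι.app (CostructuredArrow.mk x) := by
      refine exists_hom_of_homNerve J (fun c x => s.ι.app (CostructuredArrow.mk x))
        fun c c' t x => ?_
      let α : CostructuredArrow.mk (J.map t ≫ x) ⟶ CostructuredArrow.mk x :=
        CostructuredArrow.homMk t
      exact (s.w α).symm
    choose desc hdesc using this
    have key (j : CostructuredArrow J Y) {Z : T} (m : Y ⟶ Z) :
        ((Functor.LeftExtension.mk (𝟭 T) J.rightUnitor.inv).coconeAt Y).ι.app j ≫ m = j.hom ≫ m :=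
      congrArg (· ≫ m) (Category.id_comp j.hom)
    exact ⟨{
      desc := desc
      fac s j := (key j _).trans (hdesc s j.left j.hom)
      uniq s m hm := hom_ext_of_homNerve J fun c x =>
        ((key (CostructuredArrow.mk x) m).symm.trans (hm (CostructuredArrow.mk x))).trans
          (hdesc s c x).symm }⟩

end Nerve

lemma ConeIso.of_natIso {K : Type u₁} [Category.{v₁} K] {C : Type u₂} [Category.{v₂} C]
    {D : Type w₁} [Category.{w₂} D] {F G : C ⥤ D} (e : F ≅ G) {d : K ⥤ C} (c : Cone d) :
    ConeIso (F.mapCone c) (G.mapCone c) :=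
  ⟨Functor.isoWhiskerLeft d e, e.app c.pt, fun k => by simp⟩

namespace Sketch

/-! ### Morphisms to left sketches -/

lemma IsLeft.nonempty_isColimit_map {S M : Sketch.{u}} (hM : M.IsLeft) (F : S ⟶ M)
    {K : Type (u + 1)} [Category.{u} K] {d : K ⥤ S.carrier} {δ : Cocone d} (hδ : S.cocones δ) :
    Nonempty (IsColimit (F.functor.mapCocone δ)) := by
  obtain ⟨e, c, hc, i⟩ := F.map_cocones δ hδ
  exact i.nonempty_isColimit ((hM.2 c).1 hc).2

/-- A morphism to a left sketch, from a functor that sends the specified cocones to colimit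
cocones. -/
def IsLeft.homMk {S M : Sketch.{u}} (hM : M.IsLeft) (F : S.carrier ⥤ M.carrier)
    (h₁ : ∀ {K : Type (u + 1)} [Category.{u} K] {d : K ⥤ S.carrier} (c : Cone d),
      S.cones c → ∃ (e : K ⥤ M.carrier) (c' : Cone e), M.cones c' ∧ ConeIso (F.mapCone c) c')
    (h₂ : ∀ {K : Type (u + 1)} [Category.{u} K] {d : K ⥤ S.carrier} (δ : Cocone d),
      S.cocones δ → Nonempty (IsColimit (F.mapCocone δ))) : Hom S M where
  functor := F
  map_cones := h₁
  map_cocones δ hδ := ⟨_, F.mapCocone δ,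
    (hM.2 _).2 ⟨S.essentiallySmall_of_cocones δ hδ, h₂ δ hδ⟩, CoconeIso.refl _⟩

/-- An invertible 2-cell from an isomorphism of the underlying functors. -/
def isoMk {S T : Sketch.{u}} {F G : S ⟶ T} (e : F.functor ≅ G.functor) : F ≅ G where
  hom := ⟨e.hom⟩
  inv := ⟨e.inv⟩
  hom_inv_id := Hom₂.ext e.hom_inv_id
  inv_hom_id := Hom₂.ext e.inv_hom_id

/-- The isomorphism of functors underlying an invertible 2-cell. -/
def functorIso {S T : Sketch.{u}} {F G : S ⟶ T} (e : F ≅ G) : F.functor ≅ G.functor where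
  hom := e.hom.natTrans
  inv := e.inv.natTrans
  hom_inv_id := congr_arg Hom₂.natTrans e.hom_inv_id
  inv_hom_id := congr_arg Hom₂.natTrans e.inv_hom_id

lemma isEquivalence_precomp {S T M : Sketch.{u}} (F : S ⟶ T)
    (h₁ : ∀ G G' : T ⟶ M, Function.Bijective
      fun α : G.functor ⟶ G'.functor => Functor.whiskerLeft F.functor α)
    (h₂ : ∀ H : S ⟶ M, ∃ G : T ⟶ M, Nonempty (F.functor ⋙ G.functor ≅ H.functor)) :
    (Bicategory.precomp M F).IsEquivalence where
  faithful := ⟨fun {G G'} α β h => Hom₂.ext ((h₁ G G').1 (congr_arg Hom₂.natTrans h))⟩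
  full := ⟨fun {G G'} α => by
    obtain ⟨β, hβ⟩ := (h₁ G G').2 α.natTrans
    exact ⟨⟨β⟩, Hom₂.ext hβ⟩⟩
  essSurj := ⟨fun H => by
    obtain ⟨G, ⟨e⟩⟩ := h₂ H
    exact ⟨G, ⟨isoMk e⟩⟩⟩

lemma IsLeftMoritaEquivalence.bijective {S T M : Sketch.{u}} {F : S ⟶ T}
    (hF : IsLeftMoritaEquivalence F) (hM : M.IsLeft) (G G' : T ⟶ M) : Function.Bijective
      fun α : G.functor ⟶ G'.functor => Functor.whiskerLeft F.functor α := by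
  have := hF M hM
  constructor
  · intro α β h
    have : (⟨α⟩ : Hom₂ G G') = ⟨β⟩ :=
      (Bicategory.precomp M F).map_injective (X := G) (Y := G') (Hom₂.ext h)
    exact congr_arg Hom₂.natTrans this
  · intro α
    let α' : (Bicategory.precomp M F).obj G ⟶ (Bicategory.precomp M F).obj G' := Hom₂.mk α
    exact ⟨((Bicategory.precomp M F).preimage α').natTrans,
      congr_arg Hom₂.natTrans ((Bicategory.precomp M F).map_preimage α')⟩

lemma IsLeftMoritaEquivalence.exists_extension {S T M : Sketch.{u}} {F : S ⟶ T}
    (hF : IsLeftMoritaEquivalence F) (hM : M.IsLeft) (H : S ⟶ M) :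
    ∃ G : T ⟶ M, Nonempty (F.functor ⋙ G.functor ≅ H.functor) := by
  have := hF M hM
  exact ⟨(Bicategory.precomp M F).objPreimage H,
    ⟨functorIso ((Bicategory.precomp M F).objObjPreimageIso H)⟩⟩

/-- Two morphisms to a left sketch are isomorphic if their restrictions along a left Morita
equivalence are. -/
lemma IsLeftMoritaEquivalence.nonempty_iso {S T M : Sketch.{u}} {F : S ⟶ T}
    (hF : IsLeftMoritaEquivalence F) (hM : M.IsLeft) {G G' : T ⟶ M}
    (e : F.functor ⋙ G.functor ≅ F.functor ⋙ G'.functor) : Nonempty (G.functor ≅ G'.functor) := by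
  have := hF M hM
  let e' : (Bicategory.precomp M F).obj G ≅ (Bicategory.precomp M F).obj G' := isoMk e
  exact ⟨functorIso ((Bicategory.precomp M F).preimageIso e')⟩

lemma IsLeftMoritaEquivalence.comp {S T R : Sketch.{u}} {F : S ⟶ T} {G : T ⟶ R}
    (hF : IsLeftMoritaEquivalence F) (hG : IsLeftMoritaEquivalence G) :
    IsLeftMoritaEquivalence (F ≫ G) := by
  intro M hM
  have := hF M hM
  have := hG M hM
  exact Functor.isEquivalence_of_iso (F := Bicategory.precomp M G ⋙ Bicategory.precomp M F)
    (Bicategory.associatorNatIsoRight F G M).symm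

/-! ### Functors that exhibit a category as the category of orthogonal presheaves -/

/-- A functor `J : S ⥤ T` to a locally small cocomplete category is classifying if its nerve
identifies `T` with the category of orthogonal presheaves on `S`. -/
structure IsClassifying (S : Sketch.{u}) {T : Type (u + 1)} [Category.{u} T]
    (J : S.carrier ⥤ T) : Prop where
  hasColimits : HasColimits T
  nonempty_isColimit : ∀ {K : Type (u + 1)} [Category.{u} K] {d : K ⥤ S.carrier} (δ : Cocone d),
    S.cocones δ → Nonempty (IsColimit (J.mapCocone δ))
  full : (homNerve J).Full
  faithful : (homNerve J).Faithful
  exists_iso : ∀ P : S.carrierᵒᵖ ⥤ Type u, S.comparisonMaps.isLocal P →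
    ∃ X : T, Nonempty ((homNerve J).obj X ≅ P)

/-- The sketch on the target of a functor `J` whose cones are the images of those of `S`, and whose
cocones are the colimit cocones. -/
def target (S : Sketch.{u}) {T : Type (u + 1)} [Category.{u} T] (J : S.carrier ⥤ T) : Sketch where
  carrier := T
  cones c := S.imageCones J c
  cocones {K _ _} c := EssentiallySmall.{u} K ∧ Nonempty (IsColimit c)
  essentiallySmall_of_cones := by
    rintro _ _ _ _ ⟨c, hc⟩
    exact S.essentiallySmall_of_cones c hc
  essentiallySmall_of_cocones c hc := hc.1

namespace IsClassifying

variable {S : Sketch.{u}} {T : Type (u + 1)} [Category.{u} T] {J : S.carrier ⥤ T}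

lemma isLeft_target (hJ : S.IsClassifying J) : (S.target J).IsLeft :=
  ⟨hJ.hasColimits, fun _ => Iff.rfl⟩

/-- A classifying functor as a morphism of sketches. -/
abbrev hom (hJ : S.IsClassifying J) : S ⟶ S.target J :=
  hJ.isLeft_target.homMk J (fun c hc => ⟨_, J.mapCone c, ⟨c, hc⟩, ConeIso.refl _⟩)
    hJ.nonempty_isColimit

lemma isLocal_nerve (hJ : S.IsClassifying J) (X : T) :
    S.comparisonMaps.isLocal ((homNerve J).obj X) :=
  (S.isLocal_comparisonMaps_iff _).2 fun δ hδ => takesToLimit_nerve (hJ.nonempty_isColimit δ hδ) X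

end IsClassifying

/-! ### The universal property of classifying functors -/

namespace IsClassifying

open Opposite

variable {S : Sketch.{u}} {T : Type (u + 1)} [Category.{u} T] {J : S.carrier ⥤ T}

/-- A cocontinuous functor is the left Kan extension of its restriction along a dense functor. -/
lemma isLeftKanExtension_of_cocontinuous (hJ : S.IsClassifying J)
    [EssentiallySmall.{u} S.carrier] {M : Type (u + 1)} [Category.{u} M] (H : T ⥤ M)
    (hH : ∀ {K : Type (u + 1)} [Category.{u} K] {d : K ⥤ T} (δ : Cocone d),
      EssentiallySmall.{u} K → IsColimit δ → Nonempty (IsColimit (H.mapCocone δ))) :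
    H.IsLeftKanExtension (𝟙 (J ⋙ H)) := by
  have := hJ.full
  have := hJ.faithful
  have := isDense_of_homNerve J
  refine Functor.LeftExtension.IsPointwiseLeftKanExtension.isLeftKanExtension
    (E := Functor.LeftExtension.mk H (𝟙 (J ⋙ H))) fun Y => ?_
  -- The comma category of `J` over `Y` is essentially small since `S.carrier` is, so `H` preserves
  -- the density colimit at `Y`.
  refine IsColimit.ofIsoColimit (hH
    ((Functor.LeftExtension.mk _ J.rightUnitor.inv).coconeAt Y) inferInstance (J.denseAt Y)).some
    (Cocone.ext (Iso.refl _) fun j => ?_)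
  refine (Category.comp_id _).trans ?_
  exact (congrArg H.map (Category.id_comp j.hom)).trans (Category.id_comp (H.map j.hom)).symm

/-- Since the Kan extension has an identity as unit, its universal property is precisely restriction
along `J`. -/
lemma bijective_whiskerLeft (hJ : S.IsClassifying J) [EssentiallySmall.{u} S.carrier]
    {M : Type (u + 1)} [Category.{u} M] (H H' : T ⥤ M)
    (hH : ∀ {K : Type (u + 1)} [Category.{u} K] {d : K ⥤ T} (δ : Cocone d),
      EssentiallySmall.{u} K → IsColimit δ → Nonempty (IsColimit (H.mapCocone δ))) :
    Function.Bijective fun α : H ⟶ H' => Functor.whiskerLeft J α := by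
  have := hJ.isLeftKanExtension_of_cocontinuous H hH
  have h : (fun α : H ⟶ H' => Functor.whiskerLeft J α) =
      Functor.homEquivOfIsLeftKanExtension (L := J) H (𝟙 (J ⋙ H)) H' := by
    funext α
    exact (Category.id_comp _).symm
  exact h ▸ Equiv.bijective _

section Extension

variable {M : Type (u + 1)} [Category.{u} M]

/-- `X` represents the orthogonal presheaf `M(F -, m)`, and `ε` is the counit at `m` of the would-be
right adjoint of `H`. Maps `H Y ⟶ m` are natural families `T(J s, Y) → M(F s, m) ≃ T(J s, X)`, that
is, maps `Y ⟶ X`. The bijection involving `α` serves to prove that `α` is invertible. -/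
lemma exists_counit (hJ : S.IsClassifying J) {F : S.carrier ⥤ M}
    (hF : ∀ {K : Type (u + 1)} [Category.{u} K] {d : K ⥤ S.carrier} (δ : Cocone d),
      S.cocones δ → Nonempty (IsColimit (F.mapCocone δ)))
    (H : T ⥤ M) (α : F ⟶ J ⋙ H) [H.IsLeftKanExtension α] [J.HasPointwiseLeftKanExtension F]
    (m : M) :
    ∃ (X : T) (ε : H.obj X ⟶ m),
      (∀ s, Function.Bijective fun g : J.obj s ⟶ X => α.app s ≫ H.map g ≫ ε) ∧
      ∀ Y, Function.Bijective fun g : Y ⟶ X => H.map g ≫ ε := by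
  have := hJ.full
  have := hJ.faithful
  obtain ⟨X, ⟨β⟩⟩ := hJ.exists_iso ((homNerve F).obj m)
    ((S.isLocal_comparisonMaps_iff _).2 fun δ hδ => takesToLimit_nerve (hF δ hδ) m)
  obtain ⟨b, hb⟩ := exists_equiv_of_homNerve_iso β
  have hb' {s s'} (t : s ⟶ s') (x : F.obj s' ⟶ m) :
      (b s).symm (F.map t ≫ x) = J.map t ≫ (b s').symm x := by
    rw [Equiv.symm_apply_eq, hb, Equiv.apply_symm_apply]
  have kan := Functor.isPointwiseLeftKanExtensionOfIsLeftKanExtension H α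
  have kan_ext {Y : T} {Z : M} {f g : H.obj Y ⟶ Z} (h : ∀ s (k : J.obj s ⟶ Y),
      α.app s ≫ H.map k ≫ f = α.app s ≫ H.map k ≫ g) : f = g := (kan Y).hom_ext' @h
  let c : Cocone (CostructuredArrow.proj J X ⋙ F) :=
    { pt := m
      ι :=
        { app j := b j.left j.hom
          naturality j j' f := by
            refine (hb f.left j'.hom).symm.trans (Eq.trans ?_ (Category.comp_id _).symm)
            rw [CostructuredArrow.w] } }
  obtain ⟨ε, hε⟩ : ∃ ε : H.obj X ⟶ m,
      ∀ {s} (g : J.obj s ⟶ X), α.app s ≫ H.map g ≫ ε = b s g :=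
    ⟨(kan X).desc c, fun g => (Category.assoc _ _ _).symm.trans
      ((kan X).fac c (CostructuredArrow.mk g))⟩
  refine ⟨X, ε, fun s => ?_, fun Y => ⟨fun g g' h => ?_, fun f => ?_⟩⟩
  · have : (fun g => α.app s ≫ H.map g ≫ ε) = b s := funext hε
    exact this ▸ (b s).bijective
  · refine hom_ext_of_homNerve J fun s k => (b s).injective ?_
    dsimp only at h
    rw [← hε, ← hε, H.map_comp, H.map_comp, Category.assoc, Category.assoc, h]
  · obtain ⟨g, hg⟩ := exists_hom_of_homNerve J
      (fun s (k : J.obj s ⟶ Y) => (b s).symm (α.app s ≫ H.map k ≫ f)) fun s s' t k => by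
        have := α.naturality_assoc t (H.map k ≫ f)
        dsimp at this
        rw [← hb', H.map_comp, Category.assoc, this]
    refine ⟨g, kan_ext fun s k => ?_⟩
    dsimp only
    rw [← H.map_comp_assoc, hε, hg, Equiv.apply_symm_apply]

lemma exists_extension [HasColimits M] (hJ : S.IsClassifying J)
    [EssentiallySmall.{u} S.carrier]
    {F : S.carrier ⥤ M}
    (hF : ∀ {K : Type (u + 1)} [Category.{u} K] {d : K ⥤ S.carrier} (δ : Cocone d),
      S.cocones δ → Nonempty (IsColimit (F.mapCocone δ))) :
    ∃ H : T ⥤ M, Nonempty (J ⋙ H ≅ F) ∧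
      ∀ {K : Type (u + 1)} [Category.{u} K] {d : K ⥤ T} (δ : Cocone d),
        Nonempty (IsColimit δ) → Nonempty (IsColimit (H.mapCocone δ)) := by
  have (Y : T) : HasColimitsOfShape (CostructuredArrow J Y) M :=
    hasColimitsOfShape_of_essentiallySmall.{u} _ _
  have : J.HasPointwiseLeftKanExtension F := fun Y => inferInstance
  let α := J.pointwiseLeftKanExtensionUnit F
  refine ⟨J.pointwiseLeftKanExtension F, ⟨?_⟩, fun δ hδ => ?_⟩
  · have (s : S.carrier) : IsIso (α.app s) := by
      rw [isIso_iff_coyoneda_map_bijective]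
      intro m
      obtain ⟨X, ε, h₁, h₂⟩ := hJ.exists_counit hF _ α m
      -- The bijection `h₁ s` is `h₂ (J.obj s)` followed by precomposition with `α.app s`, which is
      -- therefore bijective.
      exact (Function.Bijective.of_comp_iff _ (h₂ (J.obj s))).1 (h₁ s)
    have : IsIso α := NatIso.isIso_of_isIso_app α
    exact (asIso α).symm
  · rw [nonempty_isColimit_iff] at hδ ⊢
    intro m
    obtain ⟨X, ε, -, h⟩ := hJ.exists_counit hF _ α m
    -- This is the adjunction isomorphism `T(Y, X) ≅ M(H Y, m)`; left adjoints preserve colimits.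
    let θ : yoneda.obj X ≅ (J.pointwiseLeftKanExtension F).op ⋙ yoneda.obj m :=
      NatIso.ofComponents (fun Y => (Equiv.ofBijective _ (h Y.unop)).toIso) (fun f => by
        ext g
        exact (congrArg (· ≫ ε) (Functor.map_comp _ f.unop g)).trans (Category.assoc _ _ _))
    exact (hδ X).of_iso θ

end Extension

/-- A classifying functor on a sketch with an essentially small underlying category is a left
Morita equivalence. -/
lemma isLeftMoritaEquivalence_hom (hJ : S.IsClassifying J) [EssentiallySmall.{u} S.carrier] :
    IsLeftMoritaEquivalence hJ.hom := by
  intro M hM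
  refine isEquivalence_precomp _
    (fun H H' => hJ.bijective_whiskerLeft (T := T) H.functor H'.functor fun δ h h' =>
      hM.nonempty_isColimit_map H ⟨h, ⟨h'⟩⟩) fun F => ?_
  have := hM.1
  obtain ⟨H, ⟨e⟩, hH⟩ := hJ.exists_extension (F := F.functor) (fun δ => hM.nonempty_isColimit_map F)
  refine ⟨hM.homMk (S := S.target J) H ?_ fun δ hδ => hH δ hδ.2, ⟨e⟩⟩
  -- The specified cones of the target are only the images of those of `S`, on which `H` agrees with
  -- `F` up to `e`.
  rintro K _ _ _ ⟨c, hc⟩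
  obtain ⟨d', c', hc', i⟩ := F.map_cones c hc
  exact ⟨d', c', hc', (ConeIso.of_natIso e c).trans i⟩

end IsClassifying

end Sketch

/-! ### Classifying functors of small sketches -/

/-- A set of presentable objects has a common regular cardinal of presentability. -/
lemma exists_isCardinalPresentable {A : Type u₁} [Category.{v₁} A] {ι : Type u} (X : ι → A)
    [∀ i, IsPresentable.{u} (X i)] :
    ∃ (κ : Cardinal.{u}) (_ : Fact κ.IsRegular), ∀ i, IsCardinalPresentable (X i) κ := by
  have h (i : ι) : ∃ (κ : Cardinal.{u}) (_ : Fact κ.IsRegular), IsCardinalPresentable (X i) κ :=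
    Functor.IsAccessible.exists_cardinal
  choose κ hκ hX using h
  have : Fact (Order.succ (max Cardinal.aleph0 (⨆ i, κ i))).IsRegular :=
    ⟨Cardinal.isRegular_succ (le_max_left _ _)⟩
  refine ⟨_, this, fun i => isCardinalPresentable_of_le (X i) (κ := κ i) ?_⟩
  exact (le_ciSup Cardinal.bddAbove_of_small i).trans
    ((le_max_right _ _).trans (Order.le_succ _))

namespace Sketch

open Opposite

section SmallSketch

variable {C : Type u} [Category.{u} C] {I : Type u} {K : I → Type (u + 1)}
  [∀ i, Category.{u} (K i)] [∀ i, EssentiallySmall.{u} (K i)] {d : ∀ i, K i ⥤ C}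

/-- A small-orthogonality class of presheaves, determined by a set of cocones, is reflective. -/
lemma exists_reflective (δ : ∀ i, Cocone (d i)) :
    ∃ W : MorphismProperty (Cᵒᵖ ⥤ Type u), W.isLocal.ι.IsRightAdjoint ∧
      ∀ P, W.isLocal P ↔ ∀ i, TakesToLimit P (δ i) := by
  have (i : I) := hasColimitsOfShape_of_essentiallySmall.{u} (K i) (Type u)
  let f (i : I) := (colimit.isColimit (d i ⋙ yoneda)).desc (yoneda.mapCocone (δ i))
  let W := MorphismProperty.ofHoms f
  refine ⟨W, ?_, fun P => ⟨fun h i => ?_, ?_⟩⟩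
  -- A single `κ` has to serve for the sources and the targets of all comparison maps, hence the
  -- sum.
  · obtain ⟨κ, _, hκ⟩ := exists_isCardinalPresentable.{u} (A := Cᵒᵖ ⥤ Type u)
      (Sum.elim (fun i : I => colimit (d i ⋙ yoneda)) (fun i : I => yoneda.obj (δ i).pt))
    refine W.isRightAdjoint_ι_isLocal κ ?_
    rintro _ _ _ ⟨i⟩
    exact ⟨hκ (Sum.inl i), hκ (Sum.inr i)⟩
  · exact (bijective_desc_comp_iff (δ i) (colimit.isColimit _)).1 (h _ ⟨i⟩)
  · rintro h _ _ _ ⟨i⟩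
    exact (bijective_desc_comp_iff (δ i) (colimit.isColimit _)).2 (h i)

/-- A small sketch has a classifying functor. -/
lemma IsSmall.exists_isClassifying {S : Sketch.{u}} (hS : S.IsSmall) :
    ∃ (T : Type (u + 1)) (_ : Category.{u} T) (J : S.carrier ⥤ T), S.IsClassifying J := by
  obtain ⟨_, I, K, _, d, δ, hδ, hS⟩ := hS
  have (i : I) := S.essentiallySmall_of_cocones _ (hδ i)
  let e := equivSmallModel.{u} S.carrier
  obtain ⟨W, hW, hW'⟩ := exists_reflective fun i => e.functor.mapCocone (δ i)
  let adj := Adjunction.ofIsRightAdjoint W.isLocal.ι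
  let J := e.functor ⋙ yoneda ⋙ W.isLocal.ι.leftAdjoint
  let N := W.isLocal.ι ⋙ (Functor.whiskeringLeft _ _ (Type u)).obj e.functor.op
  -- By adjunction and Yoneda, maps from the reflection of `y (e c)` to `X` are the elements of `X`
  -- at `e c`.
  let θ : homNerve J ≅ N := NatIso.ofComponents
    (fun X => NatIso.ofComponents
      (fun c => ((adj.homEquiv _ X).trans yonedaEquiv).toIso)
      (fun {c c'} f => by
        ext g
        exact (congrArg yonedaEquiv (adj.homEquiv_naturality_left _ g)).trans
          (yonedaEquiv_naturality _ _).symm))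
    (fun {X Y} f => by
      ext c g
      exact congrArg yonedaEquiv (adj.homEquiv_naturality_right g f))
  -- Smallness of the sketch enters here: a condition on the set of cocones `δ i` propagates to
  -- every specified cocone.
  have hN (X : W.isLocal.FullSubcategory) {L : Type (u + 1)} [Category.{u} L]
      {d' : L ⥤ S.carrier} (ε : Cocone d') (hε : S.cocones ε) : TakesToLimit (N.obj X) ε := by
    obtain ⟨i, w, h⟩ := hS ε hε
    have h' : TakesToLimit (N.obj X) (δ i) := (hW' X.obj).1 X.property i
    exact (h'.whisker w).of_coconeIso h
  refine ⟨W.isLocal.FullSubcategory, inferInstance, J, ?_, fun ε hε => ?_, ?_, ?_, fun P hP => ?_⟩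
  · let : Reflective W.isLocal.ι := { L := _, adj := adj }
    exact hasColimits_of_reflective W.isLocal.ι
  · rw [nonempty_isColimit_iff]
    exact fun X => TakesToLimit.of_iso (θ.symm.app X) (hN X ε hε)
  · exact Functor.Full.of_iso θ.symm
  · exact Functor.Faithful.of_iso θ.symm
  · let i : e.functor.op ⋙ e.inverse.op ⋙ P ≅ P :=
      Functor.isoWhiskerRight (NatIso.op e.unitIso) P
    exact ⟨⟨e.inverse.op ⋙ P, (hW' _).2 fun j => TakesToLimit.of_iso (δ := δ j) i.symm
      ((S.isLocal_comparisonMaps_iff P).1 hP _ (hδ j))⟩, ⟨θ.app _ ≪≫ i⟩⟩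

end SmallSketch

/-! ### Classifying functors for Morita small sketches -/

/-- The opposite of the category of sets as a left sketch, with all cones over essentially small
diagrams. -/
def setOp : Sketch.{u} where
  carrier := (Type u)ᵒᵖ
  cones {K _ _} _ := EssentiallySmall.{u} K
  cocones {K _ _} c := EssentiallySmall.{u} K ∧ Nonempty (IsColimit c)
  essentiallySmall_of_cones _ h := h
  essentiallySmall_of_cocones _ h := h.1

lemma isLeft_setOp : setOp.{u}.IsLeft :=
  ⟨inferInstanceAs (HasColimits (Type u)ᵒᵖ), fun _ => Iff.rfl⟩

/-- A cocone in the opposite of sets with apex `X` is an `X`-indexed collection of compatible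
families, so amalgamations can be chosen pointwise. -/
lemma nonempty_isColimit_rightOp {K : Type u₁} [Category.{v₁} K] {C : Type u₂} [Category.{v₂} C]
    {P : Cᵒᵖ ⥤ Type u} {d : K ⥤ C} {δ : Cocone d} (h : TakesToLimit P δ) :
    Nonempty (IsColimit (P.rightOp.mapCocone δ)) := by
  rw [nonempty_isColimit_iff]
  intro X x hx
  have h' (a : X.unop) := h (fun k => (x k).unop a) fun k k' f =>
    ConcreteCategory.congr_hom (congrArg Quiver.Hom.unop (hx f)) a
  choose y hy hy' using h'
  refine ⟨Quiver.Hom.op (↾y), fun k => Quiver.Hom.unop_inj ?_, fun z hz => Quiver.Hom.unop_inj ?_⟩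
  · ext a
    exact hy a k
  · ext a
    exact hy' a _ fun k => ConcreteCategory.congr_hom (congrArg Quiver.Hom.unop (hz k)) a

/-- An orthogonal presheaf as a morphism of sketches. -/
def toSetOp {S : Sketch.{u}} (P : S.carrierᵒᵖ ⥤ Type u) (hP : S.comparisonMaps.isLocal P) :
    S ⟶ setOp :=
  isLeft_setOp.homMk P.rightOp
    (fun c hc => ⟨_, P.rightOp.mapCone c, S.essentiallySmall_of_cones c hc, ConeIso.refl _⟩)
    fun δ hδ => nonempty_isColimit_rightOp ((S.isLocal_comparisonMaps_iff P).1 hP δ hδ)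

/-- Restriction along a left Morita equivalence is fully faithful on orthogonal presheaves. -/
lemma IsLeftMoritaEquivalence.bijective_restrict {D S : Sketch.{u}} {j : D ⟶ S}
    (hj : IsLeftMoritaEquivalence j) {P Q : S.carrierᵒᵖ ⥤ Type u}
    (hP : S.comparisonMaps.isLocal P) (hQ : S.comparisonMaps.isLocal Q) :
    Function.Bijective fun α : P ⟶ Q => Functor.whiskerLeft j.functor.op α := by
  -- Passing to the opposite of sets reverses 2-cells, so `Q` comes before `P`.
  have := hj.bijective isLeft_setOp (toSetOp Q hQ) (toSetOp P hP)
  constructor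
  · intro α β h
    have := @this.1 (NatTrans.rightOp α) (NatTrans.rightOp β) (by
      ext c
      exact congrArg Quiver.Hom.op (NatTrans.congr_app h (op c)))
    ext1
    ext1 c
    exact congrArg Quiver.Hom.unop (NatTrans.congr_app this c.unop)
  · intro α
    obtain ⟨β, hβ⟩ := this.2 (NatTrans.rightOp (F := j.functor.op ⋙ P)
      (G := j.functor.op ⋙ Q) α)
    let β' : P ⟶ Q :=
      { app c := (β.app c.unop).unop
        naturality c c' f := congrArg Quiver.Hom.unop (β.naturality f.unop).symm }
    refine ⟨β', ?_⟩
    ext1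
    ext1 c
    exact congrArg Quiver.Hom.unop (NatTrans.congr_app hβ c.unop)

end Sketch

section

variable {C : Type u₁} [Category.{v₁} C] {T : Type u₂} [Category.{v₂} T]

/-- Isomorphic functors have isomorphic nerves. -/
def homNerveIso {J J' : C ⥤ T} (e : J ≅ J') : homNerve J ≅ homNerve J' :=
  Functor.isoWhiskerLeft yoneda
    ((Functor.whiskeringLeft Cᵒᵖ Tᵒᵖ (Type v₂)).mapIso (NatIso.op e.symm))

lemma bijective_whiskerLeft_of_iso {J J' : C ⥤ T} (e : J ≅ J') {M : Type w₁} [Category.{w₂} M]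
    {H H' : T ⥤ M} (h : Function.Bijective fun α : H ⟶ H' => Functor.whiskerLeft J α) :
    Function.Bijective fun α : H ⟶ H' => Functor.whiskerLeft J' α := by
  convert ((Functor.isoWhiskerRight e H).homCongr (Functor.isoWhiskerRight e H')).bijective.comp h
    using 1
  funext α
  ext c
  simp

end

namespace Sketch

open Opposite

lemma isLocal_restrict {D S : Sketch.{u}} (j : D ⟶ S) {P : S.carrierᵒᵖ ⥤ Type u}
    (hP : S.comparisonMaps.isLocal P) : D.comparisonMaps.isLocal (j.functor.op ⋙ P) := by
  rw [isLocal_comparisonMaps_iff] at hP ⊢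
  intro K _ d δ hδ
  obtain ⟨e, c, hc, i⟩ := j.map_cocones δ hδ
  exact (hP c hc).of_coconeIso i

lemma IsLeftMoritaEquivalence.nonempty_iso_presheaf {D S : Sketch.{u}} {j : D ⟶ S}
    (hj : IsLeftMoritaEquivalence j) {P Q : S.carrierᵒᵖ ⥤ Type u}
    (hP : S.comparisonMaps.isLocal P) (hQ : S.comparisonMaps.isLocal Q)
    (e : j.functor.op ⋙ P ≅ j.functor.op ⋙ Q) : Nonempty (P ≅ Q) := by
  obtain ⟨α, hα : Functor.whiskerLeft _ α = _⟩ := (hj.bijective_restrict hP hQ).2 e.hom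
  obtain ⟨β, hβ : Functor.whiskerLeft _ β = _⟩ := (hj.bijective_restrict hQ hP).2 e.inv
  refine ⟨⟨α, β, (hj.bijective_restrict hP hP).1 ?_, (hj.bijective_restrict hQ hQ).1 ?_⟩⟩
  · dsimp only
    rw [Functor.whiskerLeft_comp, hα, hβ, e.hom_inv_id]
    rfl
  · dsimp only
    rw [Functor.whiskerLeft_comp, hα, hβ, e.inv_hom_id]
    rfl

section

variable {D S : Sketch.{u}} {j : D ⟶ S} {T : Type (u + 1)} [Category.{u} T] {J : D.carrier ⥤ T}

/-- A classifying functor extends along left Morita equivalences to a classifying functor. -/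
lemma IsClassifying.of_isLeftMoritaEquivalence (hJ : D.IsClassifying J)
    (hj : IsLeftMoritaEquivalence j) (G : S.carrier ⥤ T) (e : j.functor ⋙ G ≅ J)
    (hG : ∀ {K : Type (u + 1)} [Category.{u} K] {d : K ⥤ S.carrier} (δ : Cocone d),
      S.cocones δ → Nonempty (IsColimit (G.mapCocone δ))) : S.IsClassifying G := by
  have hG' (X : T) : S.comparisonMaps.isLocal ((homNerve G).obj X) :=
    (S.isLocal_comparisonMaps_iff _).2 fun δ hδ => takesToLimit_nerve (hG δ hδ) X
  let R := (Functor.whiskeringLeft _ _ (Type u)).obj j.functor.op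
  -- The nerve of `J` is the nerve of `G` restricted along `j`. As `R` is fully faithful on
  -- orthogonal presheaves, the properties of the former pass to the latter.
  let θ : homNerve J ≅ homNerve G ⋙ R := homNerveIso e.symm
  have := hJ.full
  have := hJ.faithful
  have : (homNerve G ⋙ R).Full := Functor.Full.of_iso θ
  have : (homNerve G ⋙ R).Faithful := Functor.Faithful.of_iso θ
  refine ⟨hJ.hasColimits, hG, ⟨fun {X Y} α => ?_⟩, Functor.Faithful.of_comp _ R, fun P hP => ?_⟩
  · exact ⟨(homNerve G ⋙ R).preimage (R.map α), (hj.bijective_restrict (hG' X) (hG' Y)).1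
      ((homNerve G ⋙ R).map_preimage (R.map α))⟩
  · obtain ⟨X, ⟨i⟩⟩ := hJ.exists_iso _ (isLocal_restrict j hP)
    exact ⟨X, hj.nonempty_iso_presheaf (hG' X) hP (θ.symm.app X ≪≫ i)⟩

/-- A Morita small sketch has a classifying functor which is a left Morita equivalence. -/
lemma IsMoritaSmall.exists_isClassifying (hS : S.IsMoritaSmall) :
    ∃ (T : Type (u + 1)) (_ : Category.{u} T) (G : S.carrier ⥤ T) (hG : S.IsClassifying G),
      IsLeftMoritaEquivalence hG.hom := by
  obtain ⟨D, j, hD, hj⟩ := hS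
  obtain ⟨T, _, J, hJ⟩ := hD.exists_isClassifying
  have := hD.1
  obtain ⟨G, ⟨e⟩⟩ := hj.exists_extension hJ.isLeft_target hJ.hom
  have hG : S.IsClassifying (T := T) G.functor := hJ.of_isLeftMoritaEquivalence hj G.functor e
    fun δ => hJ.isLeft_target.nonempty_isColimit_map G
  refine ⟨T, inferInstance, G.functor, hG, fun M hM => isEquivalence_precomp _ (fun H H' => ?_)
    fun F => ?_⟩
  -- Restriction along `j` and along `j ⋙ G ≅ J` are both bijective on 2-cells, hence so is
  -- restriction along `G`.
  · refine (Function.Bijective.of_comp_iff'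
      (hj.bijective hM (hG.hom ≫ H) (hG.hom ≫ H')) _).1 ?_
    refine bijective_whiskerLeft_of_iso e.symm (hJ.bijective_whiskerLeft (T := T)
      H.functor H'.functor fun δ h h' => hM.nonempty_isColimit_map H ⟨h, ⟨h'⟩⟩)
  · obtain ⟨H, ⟨i⟩⟩ := hJ.isLeftMoritaEquivalence_hom.exists_extension hM (j ≫ F)
    obtain ⟨k⟩ := hj.nonempty_iso (G := G ≫ H) (G' := F) hM
      (Functor.isoWhiskerRight e H.functor ≪≫ i)
    -- `H` starts at the sketch whose cones come from `D`. Here the cones come from `S`, so the cone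
    -- condition is checked anew, through `G ≫ H`.
    refine ⟨hM.homMk (S := S.target (T := T) G.functor) H.functor ?_
      fun δ hδ => hM.nonempty_isColimit_map H hδ, ⟨k⟩⟩
    rintro K _ _ _ ⟨c, hc⟩
    exact (G ≫ H).map_cones c hc

end

/-- The left sketch classifier given by a classifying functor. -/
lemma IsClassifying.nonempty_leftClassifier {S : Sketch.{u}} {T : Type (u + 1)} [Category.{u} T]
    {G : S.carrier ⥤ T} (hG : S.IsClassifying G) :
    Nonempty (S.LeftClassifier (S.target G) hG.hom) := by
  have := hG.full
  have := hG.faithful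
  let N : T ⥤ S.OrthogonalPresheaf := S.comparisonMaps.isLocal.lift (homNerve G) hG.isLocal_nerve
  have : N.IsEquivalence :=
    { essSurj := ⟨fun P => by
        obtain ⟨X, ⟨i⟩⟩ := hG.exists_iso P.obj P.property
        exact ⟨X, ⟨S.comparisonMaps.isLocal.isoMk i⟩⟩⟩ }
  refine ⟨{
    equiv := N.asEquivalence
    reflection :=
      { app := yonedaMap G
        naturality s s' f := by
          ext c g
          exact G.map_comp _ _ }
    bijective_reflection := fun s P => ?_
    cones_iff := fun _ => Iff.rfl
    cocones_iff := fun _ => Iff.rfl }⟩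
  -- With `P` the nerve of some `X`, maps from the nerve of `G s` to `P` are elements of `T(G s, X)
  -- ≅ P(s)`, which Yoneda identifies with maps `y s ⟶ P`.
  let i := N.objObjPreimageIso P
  let E := (Functor.FullyFaithful.ofFullyFaithful N).homEquiv.trans
    ((Iso.refl (N.obj (G.obj s))).homCongr i)
  refine (Function.Bijective.of_comp_iff _ E.bijective).1 ?_
  refine (Function.Bijective.of_comp_iff' yonedaEquiv.bijective _).1 ?_
  have hi := ((S.orthogonalInclusion.mapIso i).app (op s)).toEquiv.bijective
  have key (k : G.obj s ⟶ N.objPreimage P) :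
      i.hom.hom.app (op s) (G.map (𝟙 s) ≫ k) = i.hom.hom.app (op s) k :=
    congrArg (i.hom.hom.app (op s))
      ((congrArg (· ≫ k) (G.map_id s)).trans (Category.id_comp k))
  exact ⟨fun k k' h => hi.1 ((key k).symm.trans (h.trans (key k'))),
    fun y => (hi.2 y).imp fun k hk => (key k).trans hk⟩

end Sketch

/-! ### Conjugating by isomorphisms -/

section

variable {C : Type u₁} [Category.{v₁} C]

/-- This and the next lemmas are the coherence axioms at one object of the image of the unit, with
the unit isomorphisms as variables; the proofs are cancellations. -/
lemma conj_eq_comp_of_comm {X X' A A' B B' Z Z' : C} (P : X ≅ Z) (P' : X' ≅ Z') (r : A ≅ B)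
    (r' : A' ≅ B') (Q : B ≅ Z) (Q' : B' ≅ Z') {m : Z ⟶ Z'} {a : X ⟶ A} {b : A ⟶ A'} {c : A' ⟶ X'}
    (b' : B ⟶ B') (ha : a = P.hom ≫ Q.inv ≫ r.inv) (hb : b = r.hom ≫ b' ≫ r'.inv)
    (hb' : b' ≫ Q'.hom = Q.hom ≫ m) (hc : c = r'.hom ≫ Q'.hom ≫ P'.inv) :
    P.hom ≫ m ≫ P'.inv = a ≫ b ≫ c := by
  subst ha hb hc
  simp [reassoc_of% hb']

lemma conj_associator {D : Type u₂} [Category.{v₂} D] (H : D ⥤ C) {X Y Y' Z W : C} {A A' E F : D}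
    (P : X ≅ Z) (k : H.obj A' ≅ Z) (t : A ≅ A') (Q : Y ≅ Z) (G : F ≅ A') (g : E ≅ F) (r : Y' ≅ W)
    (d : W ≅ Z) {a : X ⟶ H.obj A} {b : A ⟶ E} {b' : H.obj E ⟶ H.obj E} {c : H.obj E ⟶ Y'}
    {c' : H.obj F ⟶ W} {e : Y' ⟶ Y}
    (ha : a = P.hom ≫ k.inv ≫ H.map t.inv) (hb : b = t.hom ≫ G.inv ≫ g.inv) (hb' : b' = 𝟙 _)
    (hc : c = H.map g.hom ≫ c' ≫ r.inv) (hc' : c' = H.map G.hom ≫ k.hom ≫ d.inv)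
    (he : e = r.hom ≫ d.hom ≫ Q.inv) :
    P.hom ≫ 𝟙 Z ≫ Q.inv = a ≫ H.map b ≫ b' ≫ c ≫ e := by
  subst ha hb hb' hc hc' he
  simp

lemma conj_leftUnitor {X A Y Z : C} (P : X ≅ Z) (R : Y ≅ Z) {a : X ⟶ A} {b : A ⟶ Y} {b' : Y ⟶ Y}
    (i : A ≅ Y) (ha : a = P.hom ≫ R.inv ≫ i.inv) (hb : b = i.hom) (hb' : b' = 𝟙 _) :
    P.hom ≫ 𝟙 Z ≫ R.inv = a ≫ b ≫ b' := by
  subst ha hb hb'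
  simp

lemma conj_rightUnitor {X A B Y Z : C} (P : X ≅ Z) (R : Y ≅ Z) {a : X ⟶ A} {b : A ⟶ Y} {b' : Y ⟶ Y}
    (I : B ≅ Z) (r : A ≅ B) (c : B ⟶ Z) (ha : a = P.hom ≫ I.inv ≫ r.inv)
    (hb : b = r.hom ≫ c ≫ R.inv) (hc : c = I.hom) (hb' : b' = 𝟙 _) :
    P.hom ≫ 𝟙 Z ≫ R.inv = a ≫ b ≫ b' := by
  subst ha hb hc hb'
  simp

lemma comp_comp_id_eq {X Y Z : C} {p : X ⟶ Y} {q : Y ⟶ Z}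
    {r : X ⟶ Z} {i : X ⟶ X} (h : p ≫ q = r) (hi : i = 𝟙 X) :
    p ≫ q ≫ 𝟙 Z = i ≫ 𝟙 X ≫ r := by
  simp [h, hi]

end

namespace Sketch

open Bicategory

/-! ### The left sketch classifier of a Morita small sketch -/

/-- The classifier is itself Morita small because left Morita equivalences compose. -/
lemma IsMoritaSmall.exists_leftClassifier {S : Sketch.{u}} (hS : S.IsMoritaSmall) :
    ∃ (T : Sketch.{u}) (J : S ⟶ T), T.IsMoritaSmall ∧ T.IsLeft ∧ IsLeftMoritaEquivalence J ∧
      Nonempty (S.LeftClassifier T J) := by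
  obtain ⟨T, _, G, hG, h⟩ := hS.exists_isClassifying
  obtain ⟨D, j, hD, hj⟩ := hS
  exact ⟨_, hG.hom, ⟨D, j ≫ hG.hom, hD, hj.comp h⟩, hG.isLeft_target, h,
    hG.nonempty_leftClassifier⟩

/-- A left sketch is equivalent to every left sketch to which it is left Morita equivalent. -/
lemma IsLeftMoritaEquivalence.nonempty_iso_id {M T : Sketch.{u}} {J : M ⟶ T}
    (hJ : IsLeftMoritaEquivalence J) (hT : T.IsLeft) {r : T ⟶ M} (e : J ≫ r ≅ 𝟙 M) :
    Nonempty (r ≫ J ≅ 𝟙 T) := by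
  -- Restricted along `J`, the two sides become `J ≫ r ≫ J` and `J`, which `e` identifies.
  obtain ⟨i⟩ := hJ.nonempty_iso (G := r ≫ J) (G' := 𝟙 T) hT
    (Functor.isoWhiskerRight (functorIso e) J.functor)
  exact ⟨isoMk i⟩

end Sketch

namespace MoritaSmallSketch

open Bicategory Sketch

/-- The underlying sketch of the left sketch classifier of a Morita small sketch. -/
noncomputable def classifierSketch (S : MoritaSmallSketch.{u}) : Sketch.{u} :=
  (Subtype.property S : S.sketch.IsMoritaSmall).exists_leftClassifier.choose

/-- The universal morphism from a Morita small sketch to its left sketch classifier. -/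
noncomputable def classifierUnit (S : MoritaSmallSketch.{u}) : S.sketch ⟶ S.classifierSketch :=
  (Subtype.property S : S.sketch.IsMoritaSmall).exists_leftClassifier.choose_spec.choose

lemma classifierUnit_spec (S : MoritaSmallSketch.{u}) :
    S.classifierSketch.IsMoritaSmall ∧ S.classifierSketch.IsLeft ∧
      IsLeftMoritaEquivalence S.classifierUnit ∧
      Nonempty (S.sketch.LeftClassifier S.classifierSketch S.classifierUnit) :=
  (Subtype.property S : S.sketch.IsMoritaSmall).exists_leftClassifier.choose_spec.choose_spec

/-- The left sketch classifier of a Morita small sketch. -/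
noncomputable def classifier (S : MoritaSmallSketch.{u}) : MoritaSmallLeftSketch.{u} :=
  (⟨(⟨S.classifierSketch, S.classifierUnit_spec.1⟩ : {S : Sketch.{u} // S.IsMoritaSmall}),
    S.classifierUnit_spec.2.1⟩ : {S : MoritaSmallSketch.{u} // S.sketch.IsLeft})

instance (S : MoritaSmallSketch.{u}) (M : MoritaSmallLeftSketch.{u}) :
    (precomp (leftInclusion.obj M).sketch S.classifierUnit).IsEquivalence :=
  S.classifierUnit_spec.2.2.1 _ (Subtype.property M)

instance (S S' : MoritaSmallSketch.{u}) :
    (precomp S'.classifierSketch S.classifierUnit).IsEquivalence :=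
  S.classifierUnit_spec.2.2.1 _ S'.classifierUnit_spec.2.1

/-! ### The classifier on 1-cells and 2-cells, and its coherence -/

section

variable {S S' S'' : MoritaSmallSketch.{u}}

/-- Precomposition with the unit is faithful. Every pseudofunctor law below is reduced by this to
objects in the image of the unit. -/
lemma classifier_hom₂_ext {F G : S.classifierSketch ⟶ S'.classifierSketch} {α β : F ⟶ G}
    (h : ∀ x, α.natTrans.app (S.classifierUnit.functor.obj x) =
      β.natTrans.app (S.classifierUnit.functor.obj x)) : α = β :=
  (precomp S'.classifierSketch S.classifierUnit).map_injective
    (Hom₂.ext (NatTrans.ext (funext h)))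

/-- The extension of a 2-cell along the unit of the left sketch classifier. -/
noncomputable def extend₂ {F G : S.classifierSketch ⟶ S'.classifierSketch}
    (γ : S.classifierUnit ≫ F ⟶ S.classifierUnit ≫ G) : F ⟶ G :=
  (precomp S'.classifierSketch S.classifierUnit).preimage γ

lemma extend₂_app {F G : S.classifierSketch ⟶ S'.classifierSketch}
    (γ : S.classifierUnit ≫ F ⟶ S.classifierUnit ≫ G) (x : S.sketch.carrier) :
    (extend₂ γ).natTrans.app (S.classifierUnit.functor.obj x) = γ.natTrans.app x :=
  NatTrans.congr_app (congrArg Hom₂.natTrans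
    ((precomp S'.classifierSketch S.classifierUnit).map_preimage γ)) x

/-- The extension of an invertible 2-cell along the unit of the left sketch classifier. -/
noncomputable def extendIso {F G : S.classifierSketch ⟶ S'.classifierSketch}
    (γ : S.classifierUnit ≫ F ≅ S.classifierUnit ≫ G) : F ≅ G :=
  (precomp S'.classifierSketch S.classifierUnit).preimageIso γ

/-- The morphism of left sketch classifiers induced by a morphism of sketches. -/
noncomputable def classifierMap (f : S.sketch ⟶ S'.sketch) :
    S.classifierSketch ⟶ S'.classifierSketch :=
  (precomp S'.classifierSketch S.classifierUnit).objPreimage (f ≫ S'.classifierUnit)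

/-- The unit of the left sketch classifier is pseudonatural. -/
noncomputable def classifierMapIso (f : S.sketch ⟶ S'.sketch) :
    S.classifierUnit ≫ classifierMap f ≅ f ≫ S'.classifierUnit :=
  (precomp S'.classifierSketch S.classifierUnit).objObjPreimageIso (f ≫ S'.classifierUnit)

/-- The 2-cell between left sketch classifiers induced by a 2-cell of sketches. -/
noncomputable def classifierMap₂ {f g : S.sketch ⟶ S'.sketch} (α : f ⟶ g) :
    classifierMap f ⟶ classifierMap g :=
  extend₂ ((classifierMapIso f).hom ≫ α ▷ S'.classifierUnit ≫ (classifierMapIso g).inv)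

variable (S) in
/-- The construction of left sketch classifiers preserves identities. -/
noncomputable def classifierMapId : classifierMap (𝟙 S.sketch) ≅ 𝟙 S.classifierSketch :=
  extendIso (classifierMapIso (𝟙 S.sketch) ≪≫ λ_ _ ≪≫ (ρ_ _).symm)

/-- The construction of left sketch classifiers preserves compositions. -/
noncomputable def classifierMapComp (f : S.sketch ⟶ S'.sketch) (g : S'.sketch ⟶ S''.sketch) :
    classifierMap (f ≫ g) ≅ classifierMap f ≫ classifierMap g :=
  extendIso (classifierMapIso (f ≫ g) ≪≫ α_ _ _ _ ≪≫ whiskerLeftIso f (classifierMapIso g).symm ≪≫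
    (α_ _ _ _).symm ≪≫ whiskerRightIso (classifierMapIso f).symm (classifierMap g) ≪≫ α_ _ _ _)

/-- The components of the pseudonaturality isomorphism of the unit. -/
noncomputable def unitIso (f : S.sketch ⟶ S'.sketch) (x : S.sketch.carrier) :
    (classifierMap f).functor.obj (S.classifierUnit.functor.obj x) ≅
      S'.classifierUnit.functor.obj (f.functor.obj x) :=
  (functorIso (classifierMapIso f)).app x

/-- The components of the pseudonaturality isomorphism of the unit, at an identity. -/
noncomputable def unitIsoId (x : S.sketch.carrier) :
    (classifierMap (𝟙 S.sketch)).functor.obj (S.classifierUnit.functor.obj x) ≅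
      S.classifierUnit.functor.obj x :=
  unitIso (𝟙 S.sketch) x

/-- The components of the pseudonaturality isomorphism of the unit, at a composition. -/
noncomputable def unitIsoComp (f : S.sketch ⟶ S'.sketch) (g : S'.sketch ⟶ S''.sketch)
    (x : S.sketch.carrier) :
    (classifierMap (f ≫ g)).functor.obj (S.classifierUnit.functor.obj x) ≅
      S''.classifierUnit.functor.obj (g.functor.obj (f.functor.obj x)) :=
  unitIso (f ≫ g) x

lemma unitIso_naturality (f : S.sketch ⟶ S'.sketch) {x y : S.sketch.carrier} (a : x ⟶ y) :
    (classifierMap f).functor.map (S.classifierUnit.functor.map a) ≫ (unitIso f y).hom =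
      (unitIso f x).hom ≫ S'.classifierUnit.functor.map (f.functor.map a) :=
  (functorIso (classifierMapIso f)).hom.naturality a

/-- The components of a 2-cell are determined on the objects isomorphic to those in the image of
the unit. -/
lemma app_classifierMap_obj (f : S.sketch ⟶ S'.sketch)
    {F G : S'.classifierSketch ⟶ S''.classifierSketch} (α : F ⟶ G) (x : S.sketch.carrier) :
    α.natTrans.app ((classifierMap f).functor.obj (S.classifierUnit.functor.obj x)) =
      F.functor.map (unitIso f x).hom ≫
        α.natTrans.app (S'.classifierUnit.functor.obj (f.functor.obj x)) ≫
          G.functor.map (unitIso f x).inv := by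
  rw [← α.natTrans.naturality, ← F.functor.map_comp_assoc, Iso.hom_inv_id, F.functor.map_id,
    Category.id_comp]

lemma classifierMap₂_app {f g : S.sketch ⟶ S'.sketch} (α : f ⟶ g) (x : S.sketch.carrier) :
    (classifierMap₂ α).natTrans.app (S.classifierUnit.functor.obj x) =
      (unitIso f x).hom ≫ S'.classifierUnit.functor.map (α.natTrans.app x) ≫ (unitIso g x).inv :=
  extend₂_app _ x

lemma classifierMapId_hom_app (x : S.sketch.carrier) :
    (classifierMapId S).hom.natTrans.app (S.classifierUnit.functor.obj x) = (unitIsoId x).hom := by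
  refine (extend₂_app _ x).trans ?_
  change (unitIsoId x).hom ≫ 𝟙 _ ≫ 𝟙 _ = _
  rw [Category.comp_id, Category.comp_id]

lemma classifierMapComp_hom_app (f : S.sketch ⟶ S'.sketch) (g : S'.sketch ⟶ S''.sketch)
    (x : S.sketch.carrier) :
    (classifierMapComp f g).hom.natTrans.app (S.classifierUnit.functor.obj x) =
      (unitIsoComp f g x).hom ≫ (unitIso g (f.functor.obj x)).inv ≫
        (classifierMap g).functor.map (unitIso f x).inv := by
  refine (extend₂_app _ x).trans ?_
  change (unitIsoComp f g x).hom ≫ 𝟙 _ ≫ (unitIso g (f.functor.obj x)).inv ≫ 𝟙 _ ≫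
    (classifierMap g).functor.map (unitIso f x).inv ≫ 𝟙 _ = _
  rw [Category.comp_id, Category.id_comp, Category.id_comp]

lemma classifierMapComp_inv_app (f : S.sketch ⟶ S'.sketch) (g : S'.sketch ⟶ S''.sketch)
    (x : S.sketch.carrier) :
    (classifierMapComp f g).inv.natTrans.app (S.classifierUnit.functor.obj x) =
      (classifierMap g).functor.map (unitIso f x).hom ≫ (unitIso g (f.functor.obj x)).hom ≫
        (unitIsoComp f g x).inv := by
  refine (extend₂_app _ x).trans ?_
  change ((((𝟙 _ ≫ (classifierMap g).functor.map (unitIso f x).hom) ≫ 𝟙 _) ≫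
    (unitIso g (f.functor.obj x)).hom) ≫ 𝟙 _) ≫ (unitIsoComp f g x).inv = _
  rw [Category.comp_id, Category.id_comp, Category.comp_id, Category.assoc]

lemma classifierMap₂_id (f : S.sketch ⟶ S'.sketch) : classifierMap₂ (𝟙 f) = 𝟙 _ := by
  refine classifier_hom₂_ext fun x => (classifierMap₂_app _ x).trans ?_
  change _ ≫ S'.classifierUnit.functor.map (𝟙 (f.functor.obj x)) ≫ _ = 𝟙 _
  simp

lemma classifierMap₂_comp {f g h : S.sketch ⟶ S'.sketch} (α : f ⟶ g) (β : g ⟶ h) :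
    classifierMap₂ (α ≫ β) = classifierMap₂ α ≫ classifierMap₂ β := by
  refine classifier_hom₂_ext fun x => (classifierMap₂_app _ x).trans ?_
  change (unitIso f x).hom ≫ S'.classifierUnit.functor.map
    (α.natTrans.app x ≫ β.natTrans.app x) ≫ (unitIso h x).inv =
      (classifierMap₂ α).natTrans.app _ ≫ (classifierMap₂ β).natTrans.app _
  simp [classifierMap₂_app]

/-- The whiskered 2-cell is evaluated at an object only isomorphic to one in the image of the unit;
`app_classifierMap_obj` moves it there. -/
lemma classifierMap₂_whiskerLeft (f : S.sketch ⟶ S'.sketch) {g g' : S'.sketch ⟶ S''.sketch}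
    (β : g ⟶ g') :
    classifierMap₂ (f ◁ β) = (classifierMapComp f g).hom ≫ classifierMap f ◁ classifierMap₂ β ≫
      (classifierMapComp f g').inv :=
  classifier_hom₂_ext fun x => (classifierMap₂_app _ x).trans
    (conj_eq_comp_of_comm (unitIsoComp f g x) (unitIsoComp f g' x)
      ((classifierMap g).functor.mapIso (unitIso f x))
      ((classifierMap g').functor.mapIso (unitIso f x))
      (unitIso g (f.functor.obj x)) (unitIso g' (f.functor.obj x)) _
      (classifierMapComp_hom_app f g x) (app_classifierMap_obj f (classifierMap₂ β) x)
      (by simp [classifierMap₂_app]; rfl) (classifierMapComp_inv_app f g' x))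

lemma classifierMap₂_whiskerRight {f f' : S.sketch ⟶ S'.sketch} (α : f ⟶ f')
    (g : S'.sketch ⟶ S''.sketch) :
    classifierMap₂ (α ▷ g) = (classifierMapComp f g).hom ≫ classifierMap₂ α ▷ classifierMap g ≫
      (classifierMapComp f' g).inv :=
  classifier_hom₂_ext fun x => (classifierMap₂_app _ x).trans
    (conj_eq_comp_of_comm (unitIsoComp f g x) (unitIsoComp f' g x)
      ((classifierMap g).functor.mapIso (unitIso f x))
      ((classifierMap g).functor.mapIso (unitIso f' x))
      (unitIso g (f.functor.obj x)) (unitIso g (f'.functor.obj x)) _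
      (classifierMapComp_hom_app f g x)
      ((congrArg (classifierMap g).functor.map (classifierMap₂_app α x)).trans (by simp))
      (unitIso_naturality g (α.natTrans.app x)) (classifierMapComp_inv_app f' g x))

lemma classifierMap₂_associator {R : MoritaSmallSketch.{u}} (f : S.sketch ⟶ S'.sketch)
    (g : S'.sketch ⟶ S''.sketch) (h : S''.sketch ⟶ R.sketch) :
    classifierMap₂ (α_ f g h).hom = (classifierMapComp (f ≫ g) h).hom ≫
      (classifierMapComp f g).hom ▷ classifierMap h ≫
      (α_ (classifierMap f) (classifierMap g) (classifierMap h)).hom ≫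
      classifierMap f ◁ (classifierMapComp g h).inv ≫ (classifierMapComp f (g ≫ h)).inv := by
  refine classifier_hom₂_ext fun x => (classifierMap₂_app _ x).trans ?_
  have e := R.classifierUnit.functor.map_id (h.functor.obj (g.functor.obj (f.functor.obj x)))
  refine (congrArg (fun m => (unitIsoComp (f ≫ g) h x).hom ≫ m ≫ (unitIsoComp f (g ≫ h) x).inv)
    e).trans ?_
  exact conj_associator (classifierMap h).functor (unitIsoComp (f ≫ g) h x)
    (unitIso h (g.functor.obj (f.functor.obj x))) (unitIsoComp f g x) (unitIsoComp f (g ≫ h) x)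
    (unitIso g (f.functor.obj x)) ((classifierMap g).functor.mapIso (unitIso f x))
    ((classifierMap (g ≫ h)).functor.mapIso (unitIso f x)) (unitIsoComp g h (f.functor.obj x))
    (classifierMapComp_hom_app (f ≫ g) h x) (classifierMapComp_hom_app f g x) rfl
    (app_classifierMap_obj f (classifierMapComp g h).inv x)
    (classifierMapComp_inv_app g h (f.functor.obj x)) (classifierMapComp_inv_app f (g ≫ h) x)

lemma classifierMap₂_leftUnitor (f : S.sketch ⟶ S'.sketch) :
    classifierMap₂ (λ_ f).hom = (classifierMapComp (𝟙 S.sketch) f).hom ≫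
      (classifierMapId S).hom ▷ classifierMap f ≫ (λ_ (classifierMap f)).hom := by
  refine classifier_hom₂_ext fun x => (classifierMap₂_app _ x).trans ?_
  have e := S'.classifierUnit.functor.map_id (f.functor.obj x)
  refine (congrArg (fun m => (unitIsoComp (𝟙 S.sketch) f x).hom ≫ m ≫ (unitIso f x).inv)
    e).trans ?_
  exact conj_leftUnitor (unitIsoComp (𝟙 S.sketch) f x) (unitIso f x)
    ((classifierMap f).functor.mapIso (unitIsoId x))
    (classifierMapComp_hom_app (𝟙 S.sketch) f x)
    (congrArg (classifierMap f).functor.map (classifierMapId_hom_app x)) rfl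

lemma classifierMap₂_rightUnitor (f : S.sketch ⟶ S'.sketch) :
    classifierMap₂ (ρ_ f).hom = (classifierMapComp f (𝟙 S'.sketch)).hom ≫
      classifierMap f ◁ (classifierMapId S').hom ≫ (ρ_ (classifierMap f)).hom := by
  refine classifier_hom₂_ext fun x => (classifierMap₂_app _ x).trans ?_
  have e := S'.classifierUnit.functor.map_id (f.functor.obj x)
  refine (congrArg (fun m => (unitIsoComp f (𝟙 S'.sketch) x).hom ≫ m ≫ (unitIso f x).inv)
    e).trans ?_
  exact conj_rightUnitor (unitIsoComp f (𝟙 S'.sketch) x) (unitIso f x)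
    (unitIsoId (f.functor.obj x)) ((classifierMap (𝟙 S'.sketch)).functor.mapIso (unitIso f x)) _
    (classifierMapComp_hom_app f (𝟙 S'.sketch) x)
    (app_classifierMap_obj f (classifierMapId S').hom x)
    (classifierMapId_hom_app (f.functor.obj x)) rfl

end

/-- The left sketch classifier as a pseudofunctor. -/
noncomputable def classifierPseudofunctor :
    Pseudofunctor MoritaSmallSketch.{u} MoritaSmallLeftSketch.{u} where
  obj := classifier
  map f := InducedBicategory.mkHom (InducedBicategory.mkHom (classifierMap f.hom))
  map₂ α := ⟨⟨classifierMap₂ α.hom⟩⟩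
  mapId S := InducedBicategory.isoMk (InducedBicategory.isoMk (classifierMapId S))
  mapComp f g := InducedBicategory.isoMk (InducedBicategory.isoMk (classifierMapComp f.hom g.hom))
  map₂_id f := by
    ext1; ext1
    exact classifierMap₂_id f.hom
  map₂_comp α β := by
    ext1; ext1
    exact classifierMap₂_comp α.hom β.hom
  map₂_whisker_left f _ _ α := by
    ext1; ext1
    exact classifierMap₂_whiskerLeft f.hom α.hom
  map₂_whisker_right α f := by
    ext1; ext1
    exact classifierMap₂_whiskerRight α.hom f.hom
  map₂_associator f g h := by
    ext1; ext1
    exact classifierMap₂_associator f.hom g.hom h.hom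
  map₂_left_unitor f := by
    ext1; ext1
    exact classifierMap₂_leftUnitor f.hom
  map₂_right_unitor f := by
    ext1; ext1
    exact classifierMap₂_rightUnitor f.hom

/-! ### The unit as a pseudonatural transformation, and the biadjunction -/

section

variable {S S' S'' : MoritaSmallSketch.{u}}

/-- The naturality 2-cell of the unit is the inverse of `classifierMapIso`, so the component
formulas are needed with `unitIso` moved across. -/
lemma map_comp_unitIso_inv {f g : S.sketch ⟶ S'.sketch} (α : f ⟶ g) (x : S.sketch.carrier) :
    S'.classifierUnit.functor.map (α.natTrans.app x) ≫ (unitIso g x).inv =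
      (unitIso f x).inv ≫ (classifierMap₂ α).natTrans.app (S.classifierUnit.functor.obj x) := by
  rw [classifierMap₂_app, Iso.inv_hom_id_assoc]

lemma unitIsoId_inv_comp (x : S.sketch.carrier) :
    (unitIsoId x).inv ≫
      (classifierMapId S).hom.natTrans.app (S.classifierUnit.functor.obj x) = 𝟙 _ :=
  (congrArg ((unitIsoId x).inv ≫ ·) (classifierMapId_hom_app x)).trans
    (unitIsoId x).inv_hom_id

lemma unitIsoComp_inv_comp (f : S.sketch ⟶ S'.sketch) (g : S'.sketch ⟶ S''.sketch)
    (x : S.sketch.carrier) :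
    (unitIsoComp f g x).inv ≫
        (classifierMapComp f g).hom.natTrans.app (S.classifierUnit.functor.obj x) =
      (unitIso g (f.functor.obj x)).inv ≫ (classifierMap g).functor.map (unitIso f x).inv :=
  (congrArg ((unitIsoComp f g x).inv ≫ ·) (classifierMapComp_hom_app f g x)).trans
    ((unitIsoComp f g x).inv_hom_id_assoc _)

end

/-- The unit of the left sketch classifier, as a pseudonatural transformation. -/
noncomputable def classifierStrongTrans :
    Pseudofunctor.StrongTrans (Pseudofunctor.id MoritaSmallSketch.{u})
      (classifierPseudofunctor.comp leftInclusion) where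
  app S := InducedBicategory.mkHom S.classifierUnit
  naturality f := InducedBicategory.isoMk (classifierMapIso f.hom).symm
  naturality_naturality α := by
    ext1
    exact Hom₂.ext (NatTrans.ext (funext fun x => map_comp_unitIso_inv α.hom x))
  naturality_id S := by
    ext1
    refine Hom₂.ext (NatTrans.ext (funext fun x => ?_))
    exact comp_comp_id_eq (unitIsoId_inv_comp (S := S) x) (S.classifierUnit.functor.map_id x)
  naturality_comp {S S' S''} f g := by
    ext1
    refine Hom₂.ext (NatTrans.ext (funext fun x => ?_))
    refine (comp_comp_id_eq (unitIsoComp_inv_comp f.hom g.hom x)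
      (S''.classifierUnit.functor.map_id _)).trans ?_
    refine congrArg _ (congrArg _ (congrArg _ ?_))
    exact ((Category.id_comp _).trans (Category.comp_id _)).symm

/-- Up to the wrapping of full sub-2-categories, this functor is precomposition with
`classifierUnit`. -/
lemma isEquivalence_unitHomFunctor (S : MoritaSmallSketch.{u}) (M : MoritaSmallLeftSketch.{u}) :
    (unitHomFunctor classifierPseudofunctor leftInclusion classifierStrongTrans
      S M).IsEquivalence where
  faithful := ⟨fun {F G} α β h => by
    have h' := congrArg InducedBicategory.Hom₂.hom h
    ext1; ext1
    exact (precomp (leftInclusion.obj M).sketch S.classifierUnit).map_injective h'⟩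
  full := ⟨fun {F G} γ => ⟨⟨⟨(precomp (leftInclusion.obj M).sketch S.classifierUnit).preimage
    γ.hom⟩⟩, by
      ext1
      exact (precomp (leftInclusion.obj M).sketch S.classifierUnit).map_preimage γ.hom⟩⟩
  essSurj := ⟨fun G => ⟨InducedBicategory.mkHom (InducedBicategory.mkHom
    ((precomp (leftInclusion.obj M).sketch S.classifierUnit).objPreimage G.hom)),
      ⟨InducedBicategory.isoMk
        ((precomp (leftInclusion.obj M).sketch S.classifierUnit).objObjPreimageIso G.hom)⟩⟩⟩

/-- The left sketch classifier is left biadjoint to the inclusion of left sketches. -/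
noncomputable def classifierBiadjunction :
    Biadjunction classifierPseudofunctor.{u} leftInclusion where
  unit := classifierStrongTrans
  isEquivalence := isEquivalence_unitHomFunctor

lemma isEquivalence₁_counit (M : MoritaSmallLeftSketch.{u}) :
    IsEquivalence₁ (classifierBiadjunction.counit M) := by
  have := isEquivalence_unitHomFunctor (leftInclusion.obj M) M
  have e : (unitHomFunctor classifierPseudofunctor leftInclusion classifierStrongTrans
      (leftInclusion.obj M) M).obj (classifierBiadjunction.counit M) ≅ 𝟙 (leftInclusion.obj M) :=
    (unitHomFunctor classifierPseudofunctor leftInclusion classifierStrongTrans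
      (leftInclusion.obj M) M).asEquivalence.counitIso.app (𝟙 _)
  have e' : (leftInclusion.obj M).classifierUnit ≫ (classifierBiadjunction.counit M).hom.hom ≅
      𝟙 (leftInclusion.obj M).sketch :=
    ⟨e.hom.hom, e.inv.hom, congrArg InducedBicategory.Hom₂.hom e.hom_inv_id,
      congrArg InducedBicategory.Hom₂.hom e.inv_hom_id⟩
  -- The inverse of the counit is the unit at `M`: one composite is `e'`, the other follows as the
  -- unit is a left Morita equivalence into a left sketch.
  have s := (leftInclusion.obj M).classifierUnit_spec
  obtain ⟨i⟩ := s.2.2.1.nonempty_iso_id s.2.1 e'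
  exact ⟨InducedBicategory.mkHom (InducedBicategory.mkHom (leftInclusion.obj M).classifierUnit),
    ⟨InducedBicategory.isoMk (InducedBicategory.isoMk i)⟩,
    ⟨InducedBicategory.isoMk (InducedBicategory.isoMk e')⟩⟩

end MoritaSmallSketch

theorem mainTheorem2 :
    ∃ (hat : Pseudofunctor MoritaSmallSketch.{u} MoritaSmallLeftSketch.{u})
      (adj : Biadjunction hat leftInclusion.{u}),
      (∀ S : MoritaSmallSketch.{u},
        Nonempty (Sketch.LeftClassifier S.sketch (leftInclusion.obj (hat.obj S)).sketch
          (adj.unit.app S).hom)) ∧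
      (∀ M : MoritaSmallLeftSketch.{u}, IsEquivalence₁ (adj.counit M)) :=
  ⟨MoritaSmallSketch.classifierPseudofunctor, MoritaSmallSketch.classifierBiadjunction,
    fun S => S.classifierUnit_spec.2.2.2, MoritaSmallSketch.isEquivalence₁_counit⟩
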